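/- Consider a two-party Bell scenario: Alice has $m_A$ inputs, input $x$ having $d_{A,x}$ outputs, and Bob has $m_B$ inputs, input $y$ having $d_{B,y}$ outputs (all these numbers arbitrary). A box is a vector $P=(P(a,b|x,y))\in\mathbb{R}^n$, $n=(\sum_x d_{A,x})(\sum_y d_{B,y})$. Let $\mathbf{NS}$ be the polytope of non-negative, normalized, no-signalling boxes; let $\mathbf{C}$ be the classical (Bell) polytope, i.e. the convex hull of the boxes in $\mathbf{NS}$ with all entries in $\{0,1\}$; let $\mathbf{Q}$ be the set of quantum boxes $P(a,b|x,y)=\mathrm{Tr}[\rho\,(E^A_{x,a}\otimes E^B_{y,b})]$, where $\rho$ is a density matrix on $\mathbb{C}^{N}\otimes\mathbb{C}^{N'}$ ($N,N'$ arbitrary) and $\{E^A_{x,a}\}_a$, $\{E^B_{y,b}\}_b$ are complete families of mutually orthogonal projections for each $x$ and each $y$. Let $\mathbf{Q}_{1+AB}$ (the almost quantum set) be the set of boxes $P\in\mathbf{NS}$ for which there is a complex positive semidefinite matrix $\Gamma$, indexed by the formal operators $\{\mathbb{1}\}\cup\{E^A_{x,a}E^B_{y,b}\}$, with $\Gamma_{\mathbb{1},\mathbb{1}}=1$,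 $\Gamma_{\mathbb{1},E^A_{x,a}E^B_{y,b}}=P(a,b|x,y)$, $\Gamma_{Q,R}=\Gamma_{S,T}$ whenever $Q^\dagger R=S^\dagger T$ and $\Gamma_{Q,R}=0$ whenever $Q^\dagger R=0$, where these products are simplified by $E^A_{x,a}E^A_{x,a'}=\delta_{a,a'}E^A_{x,a}$, $E^B_{y,b}E^B_{y,b'}=\delta_{b,b'}E^B_{y,b}$ and the commutation of Alice's with Bob's operators. For a polytope $K$, the inequality $B\cdot P\le\omega$ supports a facet of $K$ if it holds for all $P\in K$ and $\{P\in K: B\cdot P=\omega\}$ is non-empty of dimension $\dim K-1$. A facet Bell inequality (proper, or tight) is an inequality that supports a facet of $\mathbf{C}$ and does not support a facet of $\mathbf{NS}$. (1) Let $B\cdot P\le\omega$ be a facet Bell inequality in any two-party Bell scenario whose quantum value is attained at NPA level $1+AB$, i.e. $\sup_{P\in\mathbf{Q}}B\cdot P=\sup_{P\in\mathbf{Q}_{1+AB}}B\cdot P$. Then it is violated in quantum theory: there is $P\in\mathbf{Q}$ with $B\cdot P>\omega$. (2) Consider a two-player XOR game, with $m_A$ and $m_B$ questions, a probability distribution $q(x,y)$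 on the pairs of questions and a function $f(x,y)\in\{0,1\}$, where the players answer with bits $a,b$ and win if $a\oplus b=f(x,y)$. Its Bell functional is the winning probability $B\cdot P=\sum_{x,y}q(x,y)\sum_{a\oplus b=f(x,y)}P(a,b|x,y)$. If, for some $\omega$, the inequality $B\cdot P\le\omega$ supports a facet of $\mathbf{C}$ (for two outputs per input), then the game has a quantum advantage: $\sup_{P\in\mathbf{Q}}B\cdot P>\max_{P\in\mathbf{C}}B\cdot P$. -/

import Mathlib

noncomputable section

open scoped Matrix Kronecker ComplexOrder

/-- A two-party Bell scenario: Alice has `mA` inputs, her input `x` having `dA x` outputs;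
Bob has `mB` inputs, his input `y` having `dB y` outputs. -/
structure BellScenario where
  mA : ℕ
  dA : Fin mA → ℕ
  mB : ℕ
  dB : Fin mB → ℕ

namespace BellScenario

/-- Alice's (input, output) pairs. -/
abbrev LetterA (S : BellScenario) : Type := Σ x : Fin S.mA, Fin (S.dA x)

/-- Bob's (input, output) pairs. -/
abbrev LetterB (S : BellScenario) : Type := Σ y : Fin S.mB, Fin (S.dB y)

/-- Events `(a, b | x, y)`, written `(⟨x, a⟩, ⟨y, b⟩)`. -/
abbrev Event (S : BellScenario) : Type := S.LetterA × S.LetterB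

/-- Vectors of `ℝⁿ`, `n = (∑ x, dA x) * (∑ y, dB y)`; the coordinate at `(⟨x, a⟩, ⟨y, b⟩)` is
`P(a, b | x, y)`. Coefficient vectors of Bell functionals live in the same space. -/
abbrev Box (S : BellScenario) : Type := S.Event → ℝ

/-- The no-signalling polytope: nonnegative, normalized, no-signalling boxes. -/
structure IsNoSignalling (S : BellScenario) (P : S.Box) : Prop where
  nonneg : ∀ e, 0 ≤ P e
  normalized : ∀ x y, ∑ a, ∑ b, P (⟨x, a⟩, ⟨y, b⟩) = 1
  noSignallingAtoB : ∀ x x' y b, ∑ a, P (⟨x, a⟩, ⟨y, b⟩) = ∑ a', P (⟨x', a'⟩, ⟨y, b⟩)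
  noSignallingBtoA : ∀ y y' x a, ∑ b, P (⟨x, a⟩, ⟨y, b⟩) = ∑ b', P (⟨x, a⟩, ⟨y', b'⟩)

def noSignalling (S : BellScenario) : Set S.Box := {P | S.IsNoSignalling P}

/-- Local deterministic boxes: no-signalling boxes with all entries in `{0, 1}`. -/
def localDeterministic (S : BellScenario) : Set S.Box :=
  {P | S.IsNoSignalling P ∧ ∀ e, P e = 0 ∨ P e = 1}

/-- The classical (Bell) polytope. -/
def classical (S : BellScenario) : Set S.Box := convexHull ℝ S.localDeterministic

/-- A family of complete projective measurements on `ℂ^N`, one for each input: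
`E ⟨x, a⟩` is the projection for output `a` of input `x`. -/
structure IsProjectiveMeasurement {m : ℕ} {d : Fin m → ℕ} {N : ℕ}
    (E : (Σ x : Fin m, Fin (d x)) → Matrix (Fin N) (Fin N) ℂ) : Prop where
  hermitian : ∀ l, (E l).IsHermitian
  orthogonal : ∀ x a a', E ⟨x, a⟩ * E ⟨x, a'⟩ = if a = a' then E ⟨x, a⟩ else 0
  complete : ∀ x, ∑ a, E ⟨x, a⟩ = 1

/-- The set of quantum boxes: `P(a, b | x, y) = Tr[ρ (E_{x,a} ⊗ F_{y,b})]` for a state `ρ` on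
`ℂ^NA ⊗ ℂ^NB`, with `NA`, `NB` arbitrary. -/
def quantum (S : BellScenario) : Set S.Box :=
  {P | ∃ (NA NB : ℕ) (ρ : Matrix (Fin NA × Fin NB) (Fin NA × Fin NB) ℂ)
      (E : S.LetterA → Matrix (Fin NA) (Fin NA) ℂ)
      (F : S.LetterB → Matrix (Fin NB) (Fin NB) ℂ),
      ρ.PosSemidef ∧ ρ.trace = 1 ∧ IsProjectiveMeasurement E ∧ IsProjectiveMeasurement F ∧
      ∀ k l, ((P (k, l) : ℝ) : ℂ) = (ρ * (E k ⊗ₖ F l)).trace}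

/-- The product of two operators of one party, each being the identity (`none`) or one of the
formal projections (`some ⟨x, a⟩`), simplified with `E_{x,a} E_{x,a'} = δ_{a,a'} E_{x,a}`:
a reduced word in the projections, or `none` if the product is zero. -/
def localProd {m : ℕ} {d : Fin m → ℕ} :
    Option (Σ x : Fin m, Fin (d x)) → Option (Σ x : Fin m, Fin (d x)) →
      Option (List (Σ x : Fin m, Fin (d x)))
  | none, none => some []
  | none, some k => some [k]
  | some k, none => some [k]
  | some k, some l => if k = l then some [k] else if k.1 = l.1 then none else some [k, l]

/-- For `Q`, `R` in the operator set `{1} ∪ {E_{x,a} F_{y,b}}` of level `1 + AB` (`none` is the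
identity and `some (k, l)` is `E_k F_l`), the product `Q† R`. As Alice's projections commute with
Bob's, it is the pair of Alice's and Bob's reduced words, or `none` if the product is zero. -/
def adjProd (S : BellScenario) (Q R : Option S.Event) :
    Option (List S.LetterA × List S.LetterB) :=
  Option.map₂ Prod.mk (localProd (Q.map Prod.fst) (R.map Prod.fst))
    (localProd (Q.map Prod.snd) (R.map Prod.snd))

/-- `Γ` is a certificate of level `1 + AB` of the NPA hierarchy for the box `P`. -/
structure IsCertificate (S : BellScenario) (P : S.Box)
    (Γ : Matrix (Option S.Event) (Option S.Event) ℂ) : Prop where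
  posSemidef : Γ.PosSemidef
  one_one : Γ none none = 1
  consistent : ∀ Q R Q' R', S.adjProd Q R = S.adjProd Q' R' → Γ Q R = Γ Q' R'
  eq_zero : ∀ Q R, S.adjProd Q R = none → Γ Q R = 0
  box : ∀ e, Γ none (some e) = ((P e : ℝ) : ℂ)

/-- The almost quantum set, i.e. level `1 + AB` of the NPA hierarchy. -/
def almostQuantum (S : BellScenario) : Set S.Box :=
  {P | S.IsNoSignalling P ∧ ∃ Γ, S.IsCertificate P Γ}

/-- The largest value (supremum) of the Bell functional `B` over a set of boxes. -/
def value {S : BellScenario} (K : Set S.Box) (B : S.Box) : ℝ := sSup ((fun P => B ⬝ᵥ P) '' K)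

/-- The inequality `B · P ≤ ω` supports a facet of `K`: it is valid on `K`, and the face of `K`
where it is saturated is nonempty, of dimension `dim K - 1`. -/
structure IsFacet {S : BellScenario} (K : Set S.Box) (B : S.Box) (ω : ℝ) : Prop where
  valid : ∀ P ∈ K, B ⬝ᵥ P ≤ ω
  nonempty : {P ∈ K | B ⬝ᵥ P = ω}.Nonempty
  finrank_add_one : Module.finrank ℝ (vectorSpan ℝ {P ∈ K | B ⬝ᵥ P = ω}) + 1 =
    Module.finrank ℝ (vectorSpan ℝ K)

/-- `B · P ≤ ω` is a proper (tight) facet Bell inequality: it supports a facet of the classical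
polytope and does not also support a facet of the no-signalling polytope. -/
def IsFacetBellInequality (S : BellScenario) (B : S.Box) (ω : ℝ) : Prop :=
  IsFacet S.classical B ω ∧ ¬ IsFacet S.noSignalling B ω

/-- The scenario with `mA` and `mB` inputs and two outputs for every input. -/
def binary (mA mB : ℕ) : BellScenario := ⟨mA, fun _ => 2, mB, fun _ => 2⟩

end BellScenario

/-- A two-player XOR game: the questions `(x, y)` are drawn with probability `q x y`, and the
players win if their answer bits satisfy `a ⊕ b = f x y`. -/
structure XORGame (mA mB : ℕ) where
  q : Fin mA → Fin mB → ℝ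
  q_nonneg : ∀ x y, 0 ≤ q x y
  q_sum : ∑ x, ∑ y, q x y = 1
  f : Fin mA → Fin mB → Fin 2

/-- The Bell functional of an XOR game: `B · P` is the winning probability
`∑ x y, q x y * P(a ⊕ b = f x y | x, y)`. Addition in `Fin 2` is modulo 2. -/
def XORGame.bell {mA mB : ℕ} (G : XORGame mA mB) : (BellScenario.binary mA mB).Box :=
  fun e =>
    let a : Fin 2 := e.1.2
    let b : Fin 2 := e.2.2
    if a + b = G.f e.1.1 e.2.1 then G.q e.1.1 e.2.1 else 0

end

/-!
Both parts are duality arguments.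

Suppose that `B · P ≤ ω` holds on the almost quantum set, and let `V` be the space of affine
functions of the box, restricted to the deterministic boxes. M. Riesz extension gives a positive
semidefinite matrix `β` on the pairs of deterministic strategies, whose rows lie in `V` and which
induces the same functional as the slack `ω - B · P`. If the inequality supports a facet of the
classical polytope, every row of `β` is a multiple of the slack, so `β` has rank one. Testing `β` on
orthogonal mixtures of strategies, the slack kills one of the two. Hence its dependence on the
answers is so restricted that it is, up to a scalar, a nonnegative combination of entries of the
box; then the inequality holds for all no-signalling boxes and supports a facet of that polytope.

A functional of the correlators is maximized over quantum boxes by a semidefinite program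
(Tsirelson), whose dual solution is a diagonal matrix. If the quantum maximum were `ω`,
complementary slackness would give affine functions that vanish on the facet. They are multiples of
the slack, but they change sign when all outputs are flipped, whereas the slack does not. So they
vanish, which makes `B` constant on the deterministic boxes.
-/

noncomputable section

open scoped Matrix Kronecker ComplexOrder

/-! ### Extension of positive functionals on matrices -/

open scoped MatrixOrder Matrix.Norms.L2Operator in
lemma exists_eq_conjTranspose_mul_self_of_posSemidef {𝕜 n : Type*} [RCLike 𝕜] [Fintype n]
    {A : Matrix n n 𝕜} (hA : A.PosSemidef) : ∃ B : Matrix n n 𝕜, A = Bᴴ * B := by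
  classical exact CStarAlgebra.nonneg_iff_eq_star_mul_self.mp hA.nonneg

section TraceExtension

variable {T : Type*} [Fintype T]

lemma trace_mul_vecMulVec (φ : Matrix T T ℝ) (u w : T → ℝ) :
    (φ * Matrix.vecMulVec u w).trace = w ⬝ᵥ φ *ᵥ u := by
  rw [Matrix.mul_vecMulVec, Matrix.trace_vecMulVec, dotProduct_comm]

lemma exists_eq_trace_mul (g : Matrix T T ℝ →ₗ[ℝ] ℝ) :
    ∃ γ : Matrix T T ℝ, ∀ c, g c = (γ * c).trace := by
  classical
  refine ⟨Matrix.of fun i j => g (Matrix.single j i 1), fun c => ?_⟩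
  conv_lhs => rw [Matrix.matrix_eq_sum_single c]
  simp only [map_sum, Matrix.trace, Matrix.diag_apply, Matrix.mul_apply, Matrix.of_apply]
  rw [Finset.sum_comm]
  refine Finset.sum_congr rfl fun i _ => Finset.sum_congr rfl fun j _ => ?_
  rw [mul_comm, ← smul_eq_mul, ← map_smul, Matrix.smul_single, smul_eq_mul, mul_one]

/-- The cone of matrices whose quadratic form is nonnegative on the subspace `V`. -/
def nonnegFormCone (V : Submodule ℝ (T → ℝ)) : PointedCone ℝ (Matrix T T ℝ) where
  carrier := {c | ∀ u ∈ V, 0 ≤ u ⬝ᵥ c *ᵥ u}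
  add_mem' hc hd u hu := by
    rw [Matrix.add_mulVec, dotProduct_add]
    exact add_nonneg (hc u hu) (hd u hu)
  zero_mem' u _ := by simp
  smul_mem' r c hc u hu := by
    change 0 ≤ u ⬝ᵥ ((r : ℝ) • c) *ᵥ u
    rw [Matrix.smul_mulVec, dotProduct_smul]
    exact mul_nonneg r.2 (hc u hu)

variable {V : Submodule ℝ (T → ℝ)}

lemma transpose_mem_nonnegFormCone {c : Matrix T T ℝ} (hc : c ∈ nonnegFormCone V) :
    cᵀ ∈ nonnegFormCone V := fun u hu => by
  rw [Matrix.mulVec_transpose, dotProduct_comm, ← Matrix.dotProduct_mulVec]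
  exact hc u hu

lemma vecMulVec_self_mem_nonnegFormCone (x : T → ℝ) :
    Matrix.vecMulVec x x ∈ nonnegFormCone V := fun u _ => by
  rw [Matrix.vecMulVec_mulVec, op_smul_eq_smul, dotProduct_smul, dotProduct_comm x u]
  exact mul_self_nonneg _

lemma neg_vecMulVec_self_mem_nonnegFormCone {x : T → ℝ} (hx : ∀ u ∈ V, u ⬝ᵥ x = 0) :
    -Matrix.vecMulVec x x ∈ nonnegFormCone V := fun u hu => by
  rw [Matrix.neg_mulVec, Matrix.vecMulVec_mulVec, dotProduct_neg, op_smul_eq_smul,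
    dotProduct_smul, hx u hu, smul_zero, neg_zero]

lemma neg_sum_abs_mul_le_dotProduct_mulVec (c : Matrix T T ℝ) (u : T → ℝ) :
    -((∑ i, ∑ j, |c i j|) * (u ⬝ᵥ u)) ≤ u ⬝ᵥ c *ᵥ u := by
  have h_le (k : T) : u k * u k ≤ u ⬝ᵥ u :=
    Finset.single_le_sum (fun i _ => mul_self_nonneg (u i)) (Finset.mem_univ k)
  have h_abs (i j : T) : |u i * u j| ≤ u ⬝ᵥ u := by
    have := h_le i
    have := h_le j
    exact abs_le.2 ⟨by nlinarith [sq_nonneg (u i + u j)], by nlinarith [sq_nonneg (u i - u j)]⟩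
  have h_form : u ⬝ᵥ c *ᵥ u = ∑ i, ∑ j, u i * (c i j * u j) := by
    simp only [dotProduct, Matrix.mulVec, Finset.mul_sum]
  rw [h_form, Finset.sum_mul, ← Finset.sum_neg_distrib]
  refine Finset.sum_le_sum fun i _ => ?_
  rw [Finset.sum_mul, ← Finset.sum_neg_distrib]
  refine Finset.sum_le_sum fun j _ => ?_
  calc -(|c i j| * (u ⬝ᵥ u)) ≤ -(|c i j| * |u i * u j|) := by gcongr; exact h_abs i j
    _ = -|u i * (c i j * u j)| := by rw [← abs_mul, mul_left_comm]
    _ ≤ u i * (c i j * u j) := neg_abs_le _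

variable [DecidableEq T]

lemma exists_smul_one_add_mem_nonnegFormCone (c : Matrix T T ℝ) :
    ∃ t : ℝ, t • (1 : Matrix T T ℝ) + c ∈ nonnegFormCone V := by
  refine ⟨∑ i, ∑ j, |c i j|, fun u _ => ?_⟩
  rw [Matrix.add_mulVec, Matrix.smul_mulVec, Matrix.one_mulVec, dotProduct_add, dotProduct_smul,
    smul_eq_mul]
  linarith [neg_sum_abs_mul_le_dotProduct_mulVec c u]

lemma exists_trace_extension {p : Submodule ℝ (Matrix T T ℝ)} (h_symm : ∀ c ∈ p, cᵀ = c)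
    (h_one : (1 : Matrix T T ℝ) ∈ p) {φ : Matrix T T ℝ}
    (hφ : ∀ c ∈ p, c ∈ nonnegFormCone V → 0 ≤ (φ * c).trace) :
    ∃ β : Matrix T T ℝ, βᵀ = β ∧ (∀ c ∈ p, (β * c).trace = (φ * c).trace) ∧
      ∀ c ∈ nonnegFormCone V, 0 ≤ (β * c).trace := by
  let traceφ : Matrix T T ℝ →ₗ[ℝ] ℝ := Matrix.traceLinearMap T ℝ ℝ ∘ₗ LinearMap.mulLeft ℝ φ
  obtain ⟨g, hgp, hg⟩ := riesz_extension (nonnegFormCone V) ⟨p, traceφ.comp p.subtype⟩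
    (fun c hc => hφ c c.2 hc) fun c =>
      have ⟨t, ht⟩ := exists_smul_one_add_mem_nonnegFormCone (V := V) c
      ⟨⟨t • 1, p.smul_mem t h_one⟩, ht⟩
  obtain ⟨γ, hγ⟩ := exists_eq_trace_mul g
  have h_trace (c : Matrix T T ℝ) :
      (((1 / 2 : ℝ) • (γ + γᵀ)) * c).trace = (g c + g cᵀ) / 2 := by
    rw [Matrix.smul_mul, Matrix.trace_smul, add_mul, Matrix.trace_add, hγ, hγ,
      ← Matrix.trace_transpose (γᵀ * c), Matrix.transpose_mul, Matrix.transpose_transpose,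
      Matrix.trace_mul_comm cᵀ γ, smul_eq_mul]
    ring
  refine ⟨(1 / 2 : ℝ) • (γ + γᵀ), by simp [add_comm], fun c hc => ?_, fun c hc => ?_⟩
  · rw [h_trace, h_symm c hc, add_self_div_two]
    exact hgp ⟨c, hc⟩
  · rw [h_trace]
    have := hg c hc
    have := hg _ (transpose_mem_nonnegFormCone hc)
    positivity

/-- Vectors orthogonal to `V` are in the kernel of every extension that is nonnegative on
`nonnegFormCone V`; this is what confines the rows of `β` to `V`. -/
theorem exists_posSemidef_trace_extension {p : Submodule ℝ (Matrix T T ℝ)}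
    (h_symm : ∀ c ∈ p, cᵀ = c) (h_one : (1 : Matrix T T ℝ) ∈ p) {φ : Matrix T T ℝ}
    (hφ : ∀ c ∈ p, (∀ u ∈ V, 0 ≤ u ⬝ᵥ c *ᵥ u) → 0 ≤ (φ * c).trace) :
    ∃ β : Matrix T T ℝ, β.PosSemidef ∧ (∀ s, β s ∈ V) ∧
      ∀ c ∈ p, (β * c).trace = (φ * c).trace := by
  obtain ⟨β, hβ_symm, hβp, hβ⟩ := exists_trace_extension h_symm h_one hφ
  have hβ_psd : β.PosSemidef := by
    refine .of_dotProduct_mulVec_nonneg (by simpa [Matrix.IsHermitian] using hβ_symm) fun x => ?_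
    simpa [trace_mul_vecMulVec] using hβ _ (vecMulVec_self_mem_nonnegFormCone x)
  refine ⟨β, hβ_psd, fun s => ?_, hβp⟩
  by_contra hs
  obtain ⟨f, hfs, hfV⟩ := Submodule.exists_le_ker_of_notMem hs
  obtain ⟨x, rfl⟩ := (dotProductEquiv ℝ T).surjective f
  have hx : ∀ u ∈ V, u ⬝ᵥ x = 0 := fun u hu => by
    simpa [dotProduct_comm] using LinearMap.mem_ker.1 (hfV hu)
  have h_form : x ⬝ᵥ β *ᵥ x = 0 := by
    have h_neg := hβ _ (neg_vecMulVec_self_mem_nonnegFormCone hx)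
    have h_pos := hβ _ (vecMulVec_self_mem_nonnegFormCone x)
    rw [Matrix.mul_neg, Matrix.trace_neg] at h_neg
    rw [← trace_mul_vecMulVec]
    linarith
  have h_ker : β *ᵥ x = 0 := (hβ_psd.dotProduct_mulVec_zero_iff x).1 (by simpa using h_form)
  exact hfs (by simpa [Matrix.mulVec, dotProduct_comm] using congrFun h_ker s)

end TraceExtension

namespace BellScenario

/-! ### Facets -/

section Facets

variable {S : BellScenario} {K : Set S.Box} {B : S.Box} {ω : ℝ}

lemma IsFacet.exists_lt (h : IsFacet K B ω) : ∃ P ∈ K, B ⬝ᵥ P < ω := by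
  by_contra! hK
  have h_face : {P ∈ K | B ⬝ᵥ P = ω} = K :=
    Set.sep_eq_self_iff_mem_true.2 fun P hP => le_antisymm (h.valid P hP) (hK P hP)
  have h_dim := h.finrank_add_one
  rw [h_face] at h_dim
  omega

lemma IsFacet.value_eq (h : IsFacet K B ω) : value K B = ω := by
  obtain ⟨P, hP, hPω⟩ := h.nonempty
  exact IsGreatest.csSup_eq ⟨⟨P, hP, hPω⟩, Set.forall_mem_image.2 h.valid⟩

lemma vectorSpan_le_ker_dotProduct {F : Set S.Box} {v : S.Box} {t : ℝ}
    (h : ∀ P ∈ F, v ⬝ᵥ P = t) : vectorSpan ℝ F ≤ LinearMap.ker (dotProductBilin ℝ ℝ v) := by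
  refine Submodule.span_le.2 ?_
  rintro _ ⟨P, hP, Q, hQ, rfl⟩
  simp [dotProduct_sub, h P hP, h Q hQ]

lemma vectorSpan_face_le (K : Set S.Box) (B : S.Box) (ω : ℝ) :
    vectorSpan ℝ {P ∈ K | B ⬝ᵥ P = ω} ≤
      vectorSpan ℝ K ⊓ LinearMap.ker (dotProductBilin ℝ ℝ B) :=
  le_inf (vectorSpan_mono ℝ (Set.sep_subset _ _)) (vectorSpan_le_ker_dotProduct fun _ hP => hP.2)

lemma finrank_vectorSpan_inf_ker_lt {P Q : S.Box} (hP : P ∈ K) (hQ : Q ∈ K)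
    (hPQ : B ⬝ᵥ P ≠ B ⬝ᵥ Q) :
    Module.finrank ℝ ↥(vectorSpan ℝ K ⊓ LinearMap.ker (dotProductBilin ℝ ℝ B)) <
      Module.finrank ℝ (vectorSpan ℝ K) := by
  refine Submodule.finrank_lt_finrank_of_lt (inf_le_left.lt_of_not_ge fun h_le => hPQ ?_)
  have h_ker : B ⬝ᵥ (P - Q) = 0 := (h_le (vsub_mem_vectorSpan ℝ hP hQ)).2
  rwa [dotProduct_sub, sub_eq_zero] at h_ker

lemma IsFacet.vectorSpan_face_eq (h : IsFacet K B ω) :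
    vectorSpan ℝ {P ∈ K | B ⬝ᵥ P = ω} =
      vectorSpan ℝ K ⊓ LinearMap.ker (dotProductBilin ℝ ℝ B) := by
  obtain ⟨P, hP, hPω⟩ := h.nonempty
  obtain ⟨Q, hQ, hQω⟩ := h.exists_lt
  have := finrank_vectorSpan_inf_ker_lt hP hQ (by rw [hPω]; exact hQω.ne')
  have := h.finrank_add_one
  exact Submodule.eq_of_le_of_finrank_le (vectorSpan_face_le K B ω) (by omega)

lemma IsFacet.of_subset {C : Set S.Box} (h : IsFacet C B ω) (hCK : C ⊆ K)
    (hKC : K ⊆ affineSpan ℝ C) (h_valid : ∀ P ∈ K, B ⬝ᵥ P ≤ ω) : IsFacet K B ω := by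
  obtain ⟨P, hP, hPω⟩ := h.nonempty
  refine ⟨h_valid, ⟨P, hCK hP, hPω⟩, ?_⟩
  have h_span : vectorSpan ℝ K = vectorSpan ℝ C := by
    rw [← direction_affineSpan, ← direction_affineSpan,
      le_antisymm (affineSpan_le.2 hKC) (affineSpan_mono ℝ hCK)]
  have h_face : vectorSpan ℝ {P ∈ K | B ⬝ᵥ P = ω} = vectorSpan ℝ {P ∈ C | B ⬝ᵥ P = ω} := by
    refine le_antisymm ?_ (vectorSpan_mono ℝ fun P hP => ⟨hCK hP.1, hP.2⟩)
    rw [h.vectorSpan_face_eq, ← h_span]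
    exact vectorSpan_face_le K B ω
  rw [h_face, h_span, h.finrank_add_one]

lemma IsFacet.mul_eq_mul (h : IsFacet K B ω) {v : S.Box} {k : ℝ}
    (hv : ∀ P ∈ K, B ⬝ᵥ P = ω → k + v ⬝ᵥ P = 0) {D D' : S.Box} (hD : D ∈ K) (hD' : D' ∈ K) :
    (k + v ⬝ᵥ D) * (ω - B ⬝ᵥ D') = (k + v ⬝ᵥ D') * (ω - B ⬝ᵥ D) := by
  obtain ⟨P, hP, hPω⟩ := h.nonempty
  -- a direction of `K` along which `B` does not change, hence a direction of the facet
  let z : S.Box := (ω - B ⬝ᵥ D') • (D - P) - (ω - B ⬝ᵥ D) • (D' - P)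
  have hz : z ∈ vectorSpan ℝ {P ∈ K | B ⬝ᵥ P = ω} := by
    rw [h.vectorSpan_face_eq]
    refine ⟨sub_mem (Submodule.smul_mem _ _ (vsub_mem_vectorSpan ℝ hD hP))
      (Submodule.smul_mem _ _ (vsub_mem_vectorSpan ℝ hD' hP)), ?_⟩
    change B ⬝ᵥ z = 0
    simp only [z, dotProduct_sub, dotProduct_smul, smul_eq_mul, hPω]
    ring
  have hvz : v ⬝ᵥ z = 0 := vectorSpan_le_ker_dotProduct (t := -k)
    (fun Q hQ => by linarith [hv Q hQ.1 hQ.2]) hz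
  simp only [z, dotProduct_sub, dotProduct_smul, smul_eq_mul] at hvz
  linear_combination hvz + (B ⬝ᵥ D - B ⬝ᵥ D') * hv P hP hPω

lemma eq_zero_of_mem_convexHull {s : Set S.Box} (hs : ∀ P ∈ s, B ⬝ᵥ P ≤ ω) {v : S.Box} {k : ℝ}
    (hv : ∀ P ∈ s, B ⬝ᵥ P = ω → k + v ⬝ᵥ P = 0) :
    ∀ P ∈ convexHull ℝ s, B ⬝ᵥ P = ω → k + v ⬝ᵥ P = 0 := by
  suffices convexHull ℝ s ⊆ {P | B ⬝ᵥ P ≤ ω ∧ (B ⬝ᵥ P = ω → k + v ⬝ᵥ P = 0)} from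
    fun P hP => (this hP).2
  refine convexHull_min (fun P hP => ⟨hs P hP, hv P hP⟩) (convex_iff_forall_pos.2 ?_)
  rintro P ⟨hP_le, hP_zero⟩ Q ⟨hQ_le, hQ_zero⟩ a b ha hb hab
  obtain rfl : b = 1 - a := by linarith
  simp only [Set.mem_ofPred_eq, dotProduct_add, dotProduct_smul, smul_eq_mul]
  refine ⟨by nlinarith, fun h_eq => ?_⟩
  have hP_eq : B ⬝ᵥ P = ω := by nlinarith
  have hQ_eq : B ⬝ᵥ Q = ω := by nlinarith
  linear_combination a * hP_zero hP_eq + (1 - a) * hQ_zero hQ_eq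

lemma IsFacet.exists_eq_mul_sub {s : Set S.Box} (h : IsFacet (convexHull ℝ s) B ω) {v : S.Box}
    {k : ℝ} (hv : ∀ P ∈ s, B ⬝ᵥ P = ω → k + v ⬝ᵥ P = 0) :
    ∃ c, ∀ P ∈ convexHull ℝ s, k + v ⬝ᵥ P = c * (ω - B ⬝ᵥ P) := by
  obtain ⟨D, hD, hDω⟩ := h.exists_lt
  have hv' := eq_zero_of_mem_convexHull (fun P hP => h.valid P (subset_convexHull ℝ s hP)) hv
  refine ⟨(k + v ⬝ᵥ D) / (ω - B ⬝ᵥ D), fun P hP => ?_⟩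
  rw [div_mul_eq_mul_div, eq_div_iff (by linarith)]
  exact h.mul_eq_mul hv' hP hD

end Facets

/-! ### Deterministic strategies -/

/-- The conditional distribution `P(a | x)` of a party that answers `f x` to the input `x`. -/
def response {m : ℕ} {d : Fin m → ℕ} (f : ∀ x, Fin (d x)) (k : Σ x : Fin m, Fin (d x)) : ℝ :=
  if f k.1 = k.2 then 1 else 0

section Response

variable {m : ℕ} {d : Fin m → ℕ} (f : ∀ x, Fin (d x))

lemma response_nonneg (k : Σ x : Fin m, Fin (d x)) : 0 ≤ response f k := by
  unfold response
  positivity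

lemma sum_response_mul (x : Fin m) (c : Fin (d x) → ℝ) :
    ∑ a, response f ⟨x, a⟩ * c a = c (f x) := by
  simp [response]

lemma sum_response (x : Fin m) : ∑ a, response f ⟨x, a⟩ = 1 := by
  simp [response]

variable {V : Type*} [AddCommGroup V] [Module ℝ V] {g : (Σ x : Fin m, Fin (d x)) → V} {N : V}

lemma sum_response_update_smul (hg : ∀ x, ∑ a, g ⟨x, a⟩ = N) (k : Σ x : Fin m, Fin (d x)) :
    ∑ l : Σ x : Fin m, Fin (d x), response (Function.update f l.1 l.2) k • g l =
      g k + ((m : ℝ) - 1) • response f k • N := by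
  obtain ⟨x', a'⟩ := k
  have h_input (x : Fin m) : ∑ a, response (Function.update f x a) ⟨x', a'⟩ • g ⟨x, a⟩ =
      response f ⟨x', a'⟩ • N +
        if x = x' then g ⟨x', a'⟩ - response f ⟨x', a'⟩ • N else 0 := by
    by_cases hx : x = x'
    · subst hx
      simp [response]
    · simp [response, Function.update_of_ne (Ne.symm hx), hx, hg]
  simp only [Fintype.sum_sigma, h_input, Finset.sum_add_distrib, Finset.sum_ite_eq',
    Finset.mem_univ, if_true, Finset.sum_const, Finset.card_univ, Fintype.card_fin]
  rw [sub_smul, one_smul, Nat.cast_smul_eq_nsmul]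
  abel

lemma exists_eq_sum_response_smul [∀ x, Nonempty (Fin (d x))] (hg : ∀ x, ∑ a, g ⟨x, a⟩ = N) :
    ∃ w : (∀ x, Fin (d x)) → V, ∀ k, g k = ∑ f, response f k • w f := by
  let f₀ : ∀ x, Fin (d x) := fun x => Classical.arbitrary _
  refine ⟨fun f => (∑ l : Σ x : Fin m, Fin (d x),
    if Function.update f₀ l.1 l.2 = f then g l else 0) -
      if f₀ = f then ((m : ℝ) - 1) • N else 0, fun k => ?_⟩
  simp only [smul_sub, Finset.smul_sum, smul_ite, smul_zero, Finset.sum_sub_distrib]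
  rw [Finset.sum_comm]
  simp only [Finset.sum_ite_eq, Finset.mem_univ, if_true]
  rw [sum_response_update_smul f₀ hg, smul_comm, add_sub_cancel_right]

end Response

/-- Functions on the letters of a party whose sum over the outputs is the same for all inputs. -/
def equalSums {m : ℕ} (d : Fin m → ℕ) : Submodule ℝ ((Σ x : Fin m, Fin (d x)) → ℝ) where
  carrier := {q | ∀ x x', ∑ a, q ⟨x, a⟩ = ∑ a, q ⟨x', a⟩}
  add_mem' hq hr x x' := by simp only [Pi.add_apply, Finset.sum_add_distrib, hq x x', hr x x']
  zero_mem' x x' := by simp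
  smul_mem' c q hq x x' := by simp only [Pi.smul_apply, ← Finset.smul_sum, hq x x']

/-- Pairs of deterministic strategies of Alice and Bob. -/
abbrev Strategy (S : BellScenario) : Type := (∀ x, Fin (S.dA x)) × (∀ y, Fin (S.dB y))

/-- The box of a pair of deterministic strategies. -/
def detBox (S : BellScenario) (s : S.Strategy) : S.Box :=
  fun e => response s.1 e.1 * response s.2 e.2

/-- The scenario with Alice's and Bob's roles exchanged. -/
def swap (S : BellScenario) : BellScenario := ⟨S.mB, S.dB, S.mA, S.dA⟩

variable {S : BellScenario}

lemma dotProduct_detBox (v : S.Box) (s : S.Strategy) :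
    v ⬝ᵥ S.detBox s = ∑ x, ∑ y, v (⟨x, s.1 x⟩, ⟨y, s.2 y⟩) := by
  simp only [dotProduct, Fintype.sum_prod_type, Fintype.sum_sigma]
  refine Finset.sum_congr rfl fun x _ => ?_
  rw [Finset.sum_comm]
  refine Finset.sum_congr rfl fun y _ => ?_
  simp [detBox, response]

lemma sum_detBox_fst (w : S.Strategy → ℝ) (x : Fin S.mA) (l : S.LetterB) :
    ∑ a, (∑ s, w s • S.detBox s) (⟨x, a⟩, l) = ∑ s, w s * response s.2 l := by
  simp only [Finset.sum_apply, Pi.smul_apply, smul_eq_mul, detBox]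
  rw [Finset.sum_comm]
  simp only [← Finset.mul_sum, ← Finset.sum_mul, sum_response, one_mul]

lemma sum_detBox_snd (w : S.Strategy → ℝ) (k : S.LetterA) (y : Fin S.mB) :
    ∑ b, (∑ s, w s • S.detBox s) (k, ⟨y, b⟩) = ∑ s, w s * response s.1 k := by
  simp only [Finset.sum_apply, Pi.smul_apply, smul_eq_mul, detBox]
  rw [Finset.sum_comm]
  simp only [← Finset.mul_sum, sum_response, mul_one]

lemma sum_sum_detBox (w : S.Strategy → ℝ) (x : Fin S.mA) (y : Fin S.mB) :
    ∑ a, ∑ b, (∑ s, w s • S.detBox s) (⟨x, a⟩, ⟨y, b⟩) = ∑ s, w s := by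
  simp only [sum_detBox_snd]
  rw [Finset.sum_comm]
  simp only [← Finset.mul_sum, sum_response, mul_one]

lemma isNoSignalling_sum_smul_detBox {w : S.Strategy → ℝ} (hw : ∑ s, w s = 1)
    (h_nonneg : ∀ e, 0 ≤ (∑ s, w s • S.detBox s) e) :
    S.IsNoSignalling (∑ s, w s • S.detBox s) where
  nonneg := h_nonneg
  normalized x y := by rw [sum_sum_detBox, hw]
  noSignallingAtoB x x' y b := by rw [sum_detBox_fst, sum_detBox_fst]
  noSignallingBtoA y y' x a := by rw [sum_detBox_snd, sum_detBox_snd]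

lemma detBox_nonneg (s : S.Strategy) (e : S.Event) : 0 ≤ S.detBox s e :=
  mul_nonneg (response_nonneg _ _) (response_nonneg _ _)

lemma detBox_isNoSignalling (s : S.Strategy) : S.IsNoSignalling (S.detBox s) := by
  have h_eq : ∑ s', (Pi.single s 1 : S.Strategy → ℝ) s' • S.detBox s' = S.detBox s := by
    simp [Pi.single_apply, ite_smul]
  rw [← h_eq]
  exact isNoSignalling_sum_smul_detBox (by simp) (h_eq ▸ detBox_nonneg s)

lemma detBox_mem_localDeterministic (s : S.Strategy) : S.detBox s ∈ S.localDeterministic :=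
  ⟨detBox_isNoSignalling s, fun e => by unfold detBox response; split_ifs <;> simp⟩

lemma detBox_mem_classical (s : S.Strategy) : S.detBox s ∈ S.classical :=
  subset_convexHull ℝ _ (detBox_mem_localDeterministic s)

namespace IsNoSignalling

variable {P : S.Box}

lemma swap (hP : S.IsNoSignalling P) :
    S.swap.IsNoSignalling fun e : S.LetterB × S.LetterA => P e.swap where
  nonneg e := hP.nonneg e.swap
  normalized y x := by
    rw [Finset.sum_comm]
    exact hP.normalized x y
  noSignallingAtoB y y' x a := hP.noSignallingBtoA y y' x a
  noSignallingBtoA x x' y b := hP.noSignallingAtoB x x' y b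

lemma le_sum_snd (hP : S.IsNoSignalling P) (k : S.LetterA) (y : Fin S.mB) (b : Fin (S.dB y)) :
    P (k, ⟨y, b⟩) ≤ ∑ b', P (k, ⟨y, b'⟩) :=
  Finset.single_le_sum (f := fun b' => P (k, ⟨y, b'⟩)) (fun _ _ => hP.nonneg _)
    (Finset.mem_univ b)

lemma le_one (hP : S.IsNoSignalling P) (e : S.Event) : P e ≤ 1 := by
  obtain ⟨⟨x, a⟩, ⟨y, b⟩⟩ := e
  rw [← hP.normalized x y]
  exact (hP.le_sum_snd ⟨x, a⟩ y b).trans (Finset.single_le_sum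
    (f := fun a' => ∑ b', P (⟨x, a'⟩, ⟨y, b'⟩))
    (fun _ _ => Finset.sum_nonneg fun _ _ => hP.nonneg _) (Finset.mem_univ a))

lemma fst_eq_of_eq_one (hP : S.IsNoSignalling P) {x : Fin S.mA} {a a' : Fin (S.dA x)}
    {l l' : S.LetterB} (h : P (⟨x, a⟩, l) = 1) (h' : P (⟨x, a'⟩, l') = 1) : a = a' := by
  obtain ⟨y, b⟩ := l
  obtain ⟨y', b'⟩ := l'
  by_contra hne
  have h_one : 1 ≤ ∑ b, P (⟨x, a⟩, ⟨y, b⟩) := h ▸ hP.le_sum_snd _ y b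
  have h_one' : 1 ≤ ∑ b, P (⟨x, a'⟩, ⟨y, b⟩) := by
    rw [hP.noSignallingBtoA y y' x a', ← h']
    exact hP.le_sum_snd _ y' b'
  have h_sum := Finset.add_le_sum (f := fun a => ∑ b, P (⟨x, a⟩, ⟨y, b⟩))
    (fun a _ => Finset.sum_nonneg fun b _ => hP.nonneg _) (Finset.mem_univ a)
    (Finset.mem_univ a') hne
  rw [hP.normalized] at h_sum
  linarith

lemma snd_eq_of_eq_one (hP : S.IsNoSignalling P) {y : Fin S.mB} {b b' : Fin (S.dB y)}
    {k k' : S.LetterA} (h : P (k, ⟨y, b⟩) = 1) (h' : P (k', ⟨y, b'⟩) = 1) : b = b' :=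
  hP.swap.fst_eq_of_eq_one (l := k) (l' := k') h h'

lemma exists_eq_one (hP : S.IsNoSignalling P) (h01 : ∀ e, P e = 0 ∨ P e = 1) (x : Fin S.mA)
    (y : Fin S.mB) : ∃ a b, P (⟨x, a⟩, ⟨y, b⟩) = 1 := by
  by_contra! hne
  refine zero_ne_one (α := ℝ) ?_
  rw [← hP.normalized x y]
  exact (Finset.sum_eq_zero fun a _ => Finset.sum_eq_zero fun b _ =>
    (h01 _).resolve_right (hne a b)).symm

lemma nonempty_outputs [NeZero S.mB] (hP : S.IsNoSignalling P) (x : Fin S.mA) :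
    Nonempty (Fin (S.dA x)) := by
  by_contra h_empty
  rw [not_nonempty_iff] at h_empty
  simpa using hP.normalized x 0

end IsNoSignalling

lemma convex_noSignalling : Convex ℝ S.noSignalling := by
  intro P hP Q hQ a b ha hb hab
  refine ⟨fun e => ?_, fun x y => ?_, fun x x' y b' => ?_, fun y y' x a' => ?_⟩ <;>
    simp only [Pi.add_apply, Pi.smul_apply, smul_eq_mul, Finset.sum_add_distrib, ← Finset.mul_sum]
  · exact add_nonneg (mul_nonneg ha (hP.nonneg e)) (mul_nonneg hb (hQ.nonneg e))
  · rw [hP.normalized, hQ.normalized, mul_one, mul_one, hab]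
  · rw [hP.noSignallingAtoB x x', hQ.noSignallingAtoB x x']
  · rw [hP.noSignallingBtoA y y', hQ.noSignallingBtoA y y']

lemma classical_subset_noSignalling : S.classical ⊆ S.noSignalling :=
  convexHull_min (fun _ hP => hP.1) convex_noSignalling

lemma bddAbove_image_dotProduct {K : Set S.Box} (hK : K ⊆ S.noSignalling) (B : S.Box) :
    BddAbove ((fun P => B ⬝ᵥ P) '' K) := by
  refine ⟨∑ e, |B e|, Set.forall_mem_image.2 fun P hP => Finset.sum_le_sum fun e _ => ?_⟩
  calc B e * P e ≤ |B e| * P e := by gcongr; exacts [(hK hP).nonneg e, le_abs_self _]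
    _ ≤ |B e| := mul_le_of_le_one_right (abs_nonneg _) ((hK hP).le_one e)

lemma le_value {K : Set S.Box} (hK : K ⊆ S.noSignalling) (B : S.Box) {P : S.Box} (hP : P ∈ K) :
    B ⬝ᵥ P ≤ value K B :=
  le_csSup (bddAbove_image_dotProduct hK B) (Set.mem_image_of_mem _ hP)

section Facets

variable {K : Set S.Box} {B : S.Box} {ω : ℝ}

lemma IsFacet.nonempty_event (h : IsFacet K B ω) : Nonempty S.Event := by
  obtain ⟨P, -, hlt⟩ := h.exists_lt
  obtain ⟨Q, -, hQω⟩ := h.nonempty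
  by_contra h_empty
  rw [not_nonempty_iff] at h_empty
  rw [Subsingleton.elim P Q] at hlt
  exact hlt.ne hQω

lemma IsFacet.neZero_mA (h : IsFacet K B ω) : NeZero S.mA :=
  have ⟨e⟩ := h.nonempty_event
  ⟨(Fin.pos e.1.1).ne'⟩

lemma IsFacet.neZero_mB (h : IsFacet K B ω) : NeZero S.mB :=
  have ⟨e⟩ := h.nonempty_event
  ⟨(Fin.pos e.2.1).ne'⟩

end Facets

variable [NeZero S.mA] [NeZero S.mB]

lemma exists_detBox_eq {P : S.Box} (hP : P ∈ S.localDeterministic) : ∃ s, S.detBox s = P := by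
  obtain ⟨hNS, h01⟩ := hP
  choose f b hf using fun x => hNS.exists_eq_one h01 x 0
  choose a h hh using fun y => hNS.exists_eq_one h01 0 y
  have h_one (x y) : P (⟨x, f x⟩, ⟨y, h y⟩) = 1 := by
    obtain ⟨a', b', h_eq⟩ := hNS.exists_eq_one h01 x y
    rwa [hNS.fst_eq_of_eq_one (hf x) h_eq, hNS.snd_eq_of_eq_one (hh y) h_eq]
  refine ⟨(f, h), funext fun ⟨⟨x, a'⟩, ⟨y, b'⟩⟩ => ?_⟩
  rcases h01 (⟨x, a'⟩, ⟨y, b'⟩) with h_eq | h_eq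
  · have h_ne : ¬ (f x = a' ∧ h y = b') := by
      rintro ⟨rfl, rfl⟩
      exact zero_ne_one (h_eq.symm.trans (h_one x y))
    rw [h_eq, detBox, response, response, ite_zero_mul_ite_zero, if_neg h_ne]
  · obtain rfl := hNS.fst_eq_of_eq_one (hf x) h_eq
    obtain rfl := hNS.snd_eq_of_eq_one (hh y) h_eq
    simp [detBox, response, h_eq]

lemma classical_eq_convexHull_range : S.classical = convexHull ℝ (Set.range S.detBox) :=
  congrArg _ (Set.Subset.antisymm (fun _ hP => exists_detBox_eq hP)
    (Set.range_subset_iff.2 detBox_mem_localDeterministic))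

lemma IsFacet.exists_dotProduct_detBox_ne {B : S.Box} {ω : ℝ} (h : IsFacet S.classical B ω)
    (k : ℝ) : ∃ s, B ⬝ᵥ S.detBox s ≠ k := by
  obtain ⟨P, hP, hlt⟩ := h.exists_lt
  obtain ⟨Q, hQ, hQω⟩ := h.nonempty
  by_contra! h_const
  have h_subset : S.classical ⊆ {R | B ⬝ᵥ R = k} := by
    rw [classical_eq_convexHull_range]
    exact convexHull_min (Set.range_subset_iff.2 h_const)
      (convex_hyperplane (dotProductBilin ℝ ℝ B).isLinear k)
  exact hlt.ne ((h_subset hP).trans ((h_subset hQ).symm.trans hQω))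

lemma IsNoSignalling.exists_eq_sum_smul_detBox {P : S.Box} (hP : S.IsNoSignalling P) :
    ∃ w : S.Strategy → ℝ, ∑ s, w s = 1 ∧ P = ∑ s, w s • S.detBox s := by
  have := hP.nonempty_outputs
  have : NeZero S.swap.mA := ‹NeZero S.mB›
  have : NeZero S.swap.mB := ‹NeZero S.mA›
  have : ∀ y, Nonempty (Fin (S.dB y)) := hP.swap.nonempty_outputs
  let row (k : S.LetterA) : equalSums S.dB :=
    ⟨fun l => P (k, l), fun y y' => hP.noSignallingBtoA y y' k.1 k.2⟩
  obtain ⟨u, hu⟩ := exists_eq_sum_response_smul (g := row) (N := ∑ a, row ⟨0, a⟩) fun x =>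
    Subtype.ext <| funext fun l => by
      simpa [row] using hP.noSignallingAtoB x 0 l.1 l.2
  choose w hw using fun f => exists_eq_sum_response_smul (g := (u f).1) fun y => (u f).2 y 0
  have h_eq : P = ∑ s : S.Strategy, w s.1 s.2 • S.detBox s := funext fun ⟨k, l⟩ => by
    have h_row : P (k, l) = ∑ f, response f k * (u f).1 l := by
      simpa [row] using congrFun (congrArg Subtype.val (hu k)) l
    simp only [h_row, hw, Finset.mul_sum, Finset.sum_apply, Pi.smul_apply, smul_eq_mul, detBox,
      Fintype.sum_prod_type]
    exact Finset.sum_congr rfl fun f _ => Finset.sum_congr rfl fun h _ => by ring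
  refine ⟨fun s => w s.1 s.2, ?_, h_eq⟩
  rw [← sum_sum_detBox _ 0 0, ← h_eq, hP.normalized]

lemma noSignalling_subset_affineSpan_classical : S.noSignalling ⊆ affineSpan ℝ S.classical := by
  intro P hP
  obtain ⟨w, hw, rfl⟩ := IsNoSignalling.exists_eq_sum_smul_detBox hP
  rw [← Finset.affineCombination_eq_linear_combination _ _ _ hw]
  exact affineSpan_mono ℝ (Set.range_subset_iff.2 detBox_mem_classical)
    (affineCombination_mem_affineSpan hw S.detBox)

lemma isFacet_noSignalling {B : S.Box} {ω : ℝ} (h : IsFacet S.classical B ω)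
    (h_valid : ∀ P ∈ S.noSignalling, B ⬝ᵥ P ≤ ω) : IsFacet S.noSignalling B ω :=
  h.of_subset classical_subset_noSignalling noSignalling_subset_affineSpan_classical h_valid

end BellScenario

/-! ### Certificates from pairs of deterministic strategies -/

lemma posSemidef_map_ofReal {n : Type*} [Finite n] {A : Matrix n n ℝ} (hA : A.PosSemidef) :
    (A.map ((↑) : ℝ → ℂ)).PosSemidef := by
  have := Fintype.ofFinite n
  obtain ⟨B, rfl⟩ := exists_eq_conjTranspose_mul_self_of_posSemidef hA
  have h_map : (Bᴴ * B).map ((↑) : ℝ → ℂ) = (B.map ((↑) : ℝ → ℂ))ᴴ * B.map ((↑) : ℝ → ℂ) := by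
    ext i j
    simp [Matrix.mul_apply]
  rw [h_map]
  exact Matrix.posSemidef_conjTranspose_mul_self _

namespace BellScenario

section LocalProd

variable {m : ℕ} {d : Fin m → ℕ} {k l : Σ x : Fin m, Fin (d x)}

lemma localProd_some_some_eq_none :
    localProd (some k) (some l) = none ↔ k ≠ l ∧ k.1 = l.1 := by
  rw [localProd]
  split_ifs with h h' <;> simp [*]

lemma head?_getLast?_of_localProd_eq_some {u : List (Σ x : Fin m, Fin (d x))}
    (h : localProd (some k) (some l) = some u) :
    u.head? = some k ∧ u.getLast? = some l := by
  rw [localProd] at h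
  split_ifs at h with h_eq <;> obtain rfl := Option.some.inj h <;> simp [h_eq]

end LocalProd

variable {S : BellScenario}

lemma adjProd_some_some_eq_none {k k' : S.LetterA} {l l' : S.LetterB} :
    S.adjProd (some (k, l)) (some (k', l')) = none ↔
      k ≠ k' ∧ k.1 = k'.1 ∨ l ≠ l' ∧ l.1 = l'.1 := by
  simp only [adjProd, Option.map_some, Option.map₂_eq_none_iff, localProd_some_some_eq_none]

lemma exists_of_adjProd_eq_none {Q R : Option S.Event} (h : S.adjProd Q R = none) :
    ∃ k l k' l', Q = some (k, l) ∧ R = some (k', l') ∧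
      (k ≠ k' ∧ k.1 = k'.1 ∨ l ≠ l' ∧ l.1 = l'.1) := by
  rcases Q with _ | ⟨k, l⟩ <;> rcases R with _ | ⟨k', l'⟩
  · simp [adjProd, localProd] at h
  · simp [adjProd, localProd] at h
  · simp [adjProd, localProd] at h
  · exact ⟨k, l, k', l', rfl, rfl, adjProd_some_some_eq_none.1 h⟩

/-- The values of the formal operators `{1} ∪ {E_k F_l}` at the deterministic strategies. -/
def evalMatrix (S : BellScenario) : Matrix S.Strategy (Option S.Event) ℝ :=
  fun s Q => Q.elim 1 (S.detBox s)

/-- The moment matrix of a signed combination `c` of pairs of deterministic strategies: its entry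
at `(Q, R)` is the combination of the numbers `Q(s) R(s')` with weights `c s s'`. -/
def momentMatrix (S : BellScenario) :
    Matrix S.Strategy S.Strategy ℝ →ₗ[ℝ] Matrix (Option S.Event) (Option S.Event) ℝ where
  toFun c := S.evalMatrixᵀ * c * S.evalMatrix
  map_add' c d := by rw [Matrix.mul_add, Matrix.add_mul]
  map_smul' r c := by rw [Matrix.mul_smul, Matrix.smul_mul, RingHom.id_apply]

/-- The box that a moment matrix certifies. -/
def momentBox (S : BellScenario) : Matrix S.Strategy S.Strategy ℝ →ₗ[ℝ] S.Box :=
  LinearMap.funLeft ℝ ℝ some ∘ₗ LinearMap.proj none ∘ₗ S.momentMatrix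

lemma momentBox_apply (c : Matrix S.Strategy S.Strategy ℝ) (e : S.Event) :
    S.momentBox c e = S.momentMatrix c none (some e) := rfl

/-- The combinations whose moment matrix satisfies the linear conditions on a certificate. -/
def momentSubspace (S : BellScenario) : Submodule ℝ (Matrix S.Strategy S.Strategy ℝ) where
  carrier := {c | cᵀ = c ∧ ∀ Q R, S.adjProd Q R = none → S.momentMatrix c Q R = 0}
  add_mem' := fun ⟨hc, hc₀⟩ ⟨hd, hd₀⟩ => ⟨by rw [Matrix.transpose_add, hc, hd], fun Q R h => by
    rw [map_add, Matrix.add_apply, hc₀ Q R h, hd₀ Q R h, add_zero]⟩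
  zero_mem' := ⟨Matrix.transpose_zero, fun _ _ _ => by rw [map_zero, Matrix.zero_apply]⟩
  smul_mem' r c := fun ⟨hc, hc₀⟩ => ⟨by rw [Matrix.transpose_smul, hc], fun Q R h => by
    rw [map_smul, Matrix.smul_apply, hc₀ Q R h, smul_zero]⟩

section MomentMatrix

variable (c : Matrix S.Strategy S.Strategy ℝ)

lemma momentMatrix_vecMulVec (u w : S.Strategy → ℝ) :
    S.momentMatrix (Matrix.vecMulVec u w) =
      Matrix.vecMulVec (u ᵥ* S.evalMatrix) (w ᵥ* S.evalMatrix) := by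
  change S.evalMatrixᵀ * Matrix.vecMulVec u w * S.evalMatrix = _
  rw [Matrix.mul_vecMulVec, Matrix.vecMulVec_mul, Matrix.mulVec_transpose]

lemma transpose_momentMatrix : (S.momentMatrix c)ᵀ = S.momentMatrix cᵀ := by
  change (S.evalMatrixᵀ * c * S.evalMatrix)ᵀ = S.evalMatrixᵀ * cᵀ * S.evalMatrix
  rw [Matrix.transpose_mul, Matrix.transpose_mul, Matrix.transpose_transpose, Matrix.mul_assoc]

lemma momentMatrix_none_apply (Q : Option S.Event) :
    S.momentMatrix c none Q = ∑ s', (∑ s, c s s') * S.evalMatrix s' Q := by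
  change (S.evalMatrixᵀ * c * S.evalMatrix) none Q = _
  simp [Matrix.mul_apply, evalMatrix]

lemma momentMatrix_some_apply (e : S.Event) (Q : Option S.Event) :
    S.momentMatrix c (some e) Q =
      ∑ s', (∑ s, c s s' • S.detBox s) e * S.evalMatrix s' Q := by
  change (S.evalMatrixᵀ * c * S.evalMatrix) (some e) Q = _
  simp [Matrix.mul_apply, evalMatrix, mul_comm]

lemma momentMatrix_none_none : S.momentMatrix c none none = ∑ s', ∑ s, c s s' := by
  simp [momentMatrix_none_apply, evalMatrix]

lemma momentBox_eq_sum : S.momentBox c = ∑ s', (∑ s, c s s') • S.detBox s' := by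
  ext e
  rw [momentBox_apply, momentMatrix_none_apply]
  simp [evalMatrix]

lemma sum_momentMatrix_some (x : Fin S.mA) (y : Fin S.mB) (Q : Option S.Event) :
    ∑ a, ∑ b, S.momentMatrix c (some (⟨x, a⟩, ⟨y, b⟩)) Q = S.momentMatrix c none Q := by
  simp only [momentMatrix_some_apply, momentMatrix_none_apply]
  rw [Finset.sum_congr rfl fun a _ => Finset.sum_comm, Finset.sum_comm]
  simp only [← Finset.sum_mul, sum_sum_detBox]

variable {c}

lemma posSemidef_momentMatrix (hc : cᵀ = c)
    (h : ∀ u ∈ LinearMap.range S.evalMatrix.mulVecLin, 0 ≤ u ⬝ᵥ c *ᵥ u) :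
    (S.momentMatrix c).PosSemidef := by
  refine .of_dotProduct_mulVec_nonneg ?_ fun z => ?_
  · rw [Matrix.IsHermitian, Matrix.conjTranspose_eq_transpose_of_trivial, transpose_momentMatrix,
      hc]
  · change 0 ≤ star z ⬝ᵥ (S.evalMatrixᵀ * c * S.evalMatrix) *ᵥ z
    rw [star_trivial, Matrix.mul_assoc, ← Matrix.mulVec_mulVec, ← Matrix.mulVec_mulVec,
      Matrix.dotProduct_mulVec, Matrix.vecMul_transpose]
    exact h _ ⟨z, rfl⟩

lemma momentMatrix_comm (hc : c ∈ S.momentSubspace) (Q R : Option S.Event) :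
    S.momentMatrix c Q R = S.momentMatrix c R Q := by
  conv_lhs => rw [← hc.1, ← transpose_momentMatrix, Matrix.transpose_apply]

lemma momentMatrix_none_some (hc : c ∈ S.momentSubspace) (e : S.Event) :
    S.momentMatrix c none (some e) = S.momentMatrix c (some e) (some e) := by
  obtain ⟨⟨x, a⟩, ⟨y, b⟩⟩ := e
  have h_orthogonal (a' b') (hne : a' ≠ a ∨ b' ≠ b) :
      S.momentMatrix c (some (⟨x, a'⟩, ⟨y, b'⟩)) (some (⟨x, a⟩, ⟨y, b⟩)) = 0 :=
    hc.2 _ _ (adjProd_some_some_eq_none.2 (by simpa using hne))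
  rw [← sum_momentMatrix_some c x y, Fintype.sum_eq_single a fun a' ha =>
      Finset.sum_eq_zero fun b' _ => h_orthogonal a' b' (Or.inl ha),
    Fintype.sum_eq_single b fun b' hb => h_orthogonal a b' (Or.inr hb)]

/-- An entry of a moment matrix is determined by the first and the last letters of the reduced
words of the product of its indices. -/
lemma momentMatrix_eq_of_adjProd (hc : c ∈ S.momentSubspace) {Q R : Option S.Event}
    {u : List S.LetterA} {v : List S.LetterB} (h : S.adjProd Q R = some (u, v)) :
    S.momentMatrix c Q R = S.momentMatrix c (Option.map₂ Prod.mk u.head? v.head?)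
      (Option.map₂ Prod.mk u.getLast? v.getLast?) := by
  simp only [adjProd, Option.map₂_eq_some_iff, Prod.mk.injEq] at h
  obtain ⟨_, _, hu, hv, rfl, rfl⟩ := h
  rcases Q with _ | ⟨k, l⟩ <;> rcases R with _ | ⟨k', l'⟩
  · obtain rfl := Option.some.inj hu
    obtain rfl := Option.some.inj hv
    rfl
  · obtain rfl := Option.some.inj hu
    obtain rfl := Option.some.inj hv
    exact momentMatrix_none_some hc _
  · obtain rfl := Option.some.inj hu
    obtain rfl := Option.some.inj hv
    exact (momentMatrix_comm hc _ _).trans (momentMatrix_none_some hc _)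
  · rw [(head?_getLast?_of_localProd_eq_some hu).1, (head?_getLast?_of_localProd_eq_some hu).2,
      (head?_getLast?_of_localProd_eq_some hv).1, (head?_getLast?_of_localProd_eq_some hv).2]
    rfl

lemma isCertificate_momentMatrix (hc : c ∈ S.momentSubspace)
    (h_psd : (S.momentMatrix c).PosSemidef) (h_one : S.momentMatrix c none none = 1) :
    S.IsCertificate (S.momentBox c) ((S.momentMatrix c).map ((↑) : ℝ → ℂ)) where
  posSemidef := posSemidef_map_ofReal h_psd
  one_one := by rw [Matrix.map_apply, h_one, Complex.ofReal_one]
  consistent Q R Q' R' h := by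
    rw [Matrix.map_apply, Matrix.map_apply]
    congr 1
    rcases h_prod : S.adjProd Q R with _ | ⟨u, v⟩
    · rw [hc.2 Q R h_prod, hc.2 Q' R' (h ▸ h_prod)]
    · exact (momentMatrix_eq_of_adjProd hc h_prod).trans
        (momentMatrix_eq_of_adjProd hc (h ▸ h_prod)).symm
  eq_zero Q R h := by rw [Matrix.map_apply, hc.2 Q R h, Complex.ofReal_zero]
  box e := rfl

lemma momentBox_mem_almostQuantum (hc : c ∈ S.momentSubspace)
    (h_psd : (S.momentMatrix c).PosSemidef) (h_one : S.momentMatrix c none none = 1) :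
    S.momentBox c ∈ S.almostQuantum := by
  refine ⟨?_, _, isCertificate_momentMatrix hc h_psd h_one⟩
  rw [momentBox_eq_sum]
  refine isNoSignalling_sum_smul_detBox (by rw [← h_one, momentMatrix_none_none]) fun e => ?_
  rw [← momentBox_eq_sum, momentBox_apply, momentMatrix_none_some hc]
  exact h_psd.diag_nonneg

lemma momentBox_eq_zero (hc : c ∈ S.momentSubspace) (h_psd : (S.momentMatrix c).PosSemidef)
    (h_zero : S.momentMatrix c none none = 0) : S.momentBox c = 0 := by
  have h_ker : S.momentMatrix c *ᵥ Pi.single none 1 = 0 := by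
    rw [← h_psd.dotProduct_mulVec_zero_iff]
    simp [h_zero]
  ext e
  rw [momentBox_apply, momentMatrix_comm hc]
  simpa using congrFun h_ker (some e)

lemma dotProduct_momentBox_le {B : S.Box} {ω : ℝ} (h_valid : ∀ P ∈ S.almostQuantum, B ⬝ᵥ P ≤ ω)
    (hc : c ∈ S.momentSubspace) (h_psd : (S.momentMatrix c).PosSemidef) :
    B ⬝ᵥ S.momentBox c ≤ ω * S.momentMatrix c none none := by
  rcases (h_psd.diag_nonneg (i := none)).eq_or_lt with h_zero | h_pos
  · rw [momentBox_eq_zero hc h_psd h_zero.symm, ← h_zero, dotProduct_zero, mul_zero]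
  · have h_mem := momentBox_mem_almostQuantum
      (S.momentSubspace.smul_mem (S.momentMatrix c none none)⁻¹ hc)
      (by rw [map_smul]; exact h_psd.smul (inv_nonneg.2 h_pos.le))
      (by rw [map_smul, Matrix.smul_apply, smul_eq_mul, inv_mul_cancel₀ h_pos.ne'])
    have h_le := h_valid _ h_mem
    rwa [map_smul, dotProduct_smul, smul_eq_mul, inv_mul_le_iff₀ h_pos, mul_comm] at h_le

end MomentMatrix

/-- The slack of the inequality `B · P ≤ ω` at the deterministic boxes. -/
def slack (B : S.Box) (ω : ℝ) (s : S.Strategy) : ℝ := ω - B ⬝ᵥ S.detBox s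

lemma IsFacet.slack_nonneg {B : S.Box} {ω : ℝ} (h : IsFacet S.classical B ω) (s : S.Strategy) :
    0 ≤ slack B ω s :=
  sub_nonneg.2 (h.valid _ (detBox_mem_classical s))

lemma sum_mul_slack (B : S.Box) (ω : ℝ) (w : S.Strategy → ℝ) :
    ∑ s, w s * slack B ω s = ω * ∑ s, w s - B ⬝ᵥ ∑ s, w s • S.detBox s := by
  simp only [slack, mul_sub, Finset.sum_sub_distrib, dotProduct_sum, dotProduct_smul, smul_eq_mul,
    Finset.mul_sum, mul_comm]

lemma trace_vecMulVec_slack_mul (B : S.Box) (ω : ℝ) (c : Matrix S.Strategy S.Strategy ℝ) :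
    (Matrix.vecMulVec (slack B ω) 1 * c).trace =
      ω * S.momentMatrix c none none - B ⬝ᵥ S.momentBox c := by
  rw [momentMatrix_none_none, momentBox_eq_sum, ← sum_mul_slack, Matrix.trace_mul_comm,
    trace_mul_vecMulVec, Matrix.dotProduct_mulVec, dotProduct]
  simp [Matrix.vecMul, dotProduct]

/-! ### Orthogonal mixtures of strategies -/

section OneParty

variable {m : ℕ} {d : Fin m → ℕ}

/-- Two signed mixtures `α`, `α'` of strategies of one party are orthogonal if no product of a
probability in `α` with a probability in `α'` of a different output of the same input survives.
The products of such mixtures satisfy the vanishing conditions on certificates. -/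
def IsOrthogonalMixture (α α' : (∀ x, Fin (d x)) → ℝ) : Prop :=
  ∀ k l : Σ x : Fin m, Fin (d x), k ≠ l → k.1 = l.1 →
    (α ⬝ᵥ fun f => response f k) * (α' ⬝ᵥ fun f => response f l) = 0

/-- The difference of two strategies that differ at most in the answer to one input. -/
def variation (f : ∀ x, Fin (d x)) (x : Fin m) (a a' : Fin (d x)) : (∀ x, Fin (d x)) → ℝ :=
  Pi.single (Function.update f x a) 1 - Pi.single (Function.update f x a') 1

lemma variation_dotProduct (f : ∀ x, Fin (d x)) (x : Fin m) (a a' : Fin (d x))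
    (g : (∀ x, Fin (d x)) → ℝ) :
    variation f x a a' ⬝ᵥ g = g (Function.update f x a) - g (Function.update f x a') := by
  rw [variation, sub_dotProduct, single_one_dotProduct, single_one_dotProduct]

lemma sum_variation (f : ∀ x, Fin (d x)) (x : Fin m) (a a' : Fin (d x)) :
    ∑ g, variation f x a a' g = 0 := by
  rw [← dotProduct_one, variation_dotProduct, Pi.one_apply, Pi.one_apply, sub_self]

lemma variation_dotProduct_response (f : ∀ x, Fin (d x)) {x : Fin m} (a a' : Fin (d x))
    {k : Σ x : Fin m, Fin (d x)} (hk : k.1 ≠ x) :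
    (variation f x a a' ⬝ᵥ fun f => response f k) = 0 := by
  rw [variation_dotProduct, response, response, Function.update_of_ne hk,
    Function.update_of_ne hk, sub_self]

lemma isOrthogonalMixture_single (f : ∀ x, Fin (d x)) :
    IsOrthogonalMixture (Pi.single f 1) (Pi.single f 1) := by
  rintro ⟨x, a⟩ ⟨_, a'⟩ hne (rfl : x = _)
  rw [single_one_dotProduct, single_one_dotProduct, response, response, ite_zero_mul_ite_zero,
    if_neg]
  rintro ⟨h, h'⟩
  exact hne (congrArg _ (h.symm.trans h'))

lemma isOrthogonalMixture_variation (f f' : ∀ x, Fin (d x)) {x x' : Fin m} (hx : x ≠ x')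
    (a₁ a₂ : Fin (d x)) (a₁' a₂' : Fin (d x')) :
    IsOrthogonalMixture (variation f x a₁ a₂) (variation f' x' a₁' a₂') := fun k l _ h_eq => by
  by_cases hk : k.1 = x
  · rw [variation_dotProduct_response f' a₁' a₂' (h_eq ▸ hk ▸ hx), mul_zero]
  · rw [variation_dotProduct_response f a₁ a₂ hk, zero_mul]

end OneParty

/-- The product of signed mixtures of strategies of Alice and Bob. -/
def prodMixture (α : (∀ x, Fin (S.dA x)) → ℝ) (β : (∀ y, Fin (S.dB y)) → ℝ) : S.Strategy → ℝ :=
  fun s => α s.1 * β s.2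

section ProdMixture

variable {α α' : (∀ x, Fin (S.dA x)) → ℝ} {β β' : (∀ y, Fin (S.dB y)) → ℝ}

lemma prodMixture_single_single (s : S.Strategy) :
    prodMixture (Pi.single s.1 1) (Pi.single s.2 1) = Pi.single s 1 := by
  ext s'
  simp [prodMixture, Pi.single_apply, Prod.ext_iff, ← ite_and, and_comm]

lemma prodMixture_dotProduct (g : S.Strategy → ℝ) :
    prodMixture α β ⬝ᵥ g = α ⬝ᵥ fun f => β ⬝ᵥ fun h => g (f, h) := by
  simp only [dotProduct, prodMixture, Fintype.sum_prod_type, Finset.mul_sum, mul_assoc]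

lemma sum_prodMixture : ∑ s : S.Strategy, prodMixture α β s = (∑ f, α f) * ∑ h, β h := by
  simp only [prodMixture, Fintype.sum_prod_type, Fintype.sum_mul_sum]

lemma prodMixture_vecMul_evalMatrix (k : S.LetterA) (l : S.LetterB) :
    (prodMixture α β ᵥ* S.evalMatrix) (some (k, l)) =
      (α ⬝ᵥ fun f => response f k) * (β ⬝ᵥ fun h => response h l) := by
  change prodMixture α β ⬝ᵥ (fun s => response s.1 k * response s.2 l) = _
  rw [prodMixture_dotProduct]
  rw [dotProduct, dotProduct, dotProduct, Fintype.sum_mul_sum]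
  simp only [dotProduct, Finset.mul_sum]
  exact Finset.sum_congr rfl fun f _ => Finset.sum_congr rfl fun h _ => by ring

lemma vecMulVec_prodMixture_add_mem_momentSubspace (hα : IsOrthogonalMixture α α')
    (hβ : IsOrthogonalMixture β β') :
    Matrix.vecMulVec (prodMixture α β) (prodMixture α' β') +
      Matrix.vecMulVec (prodMixture α' β') (prodMixture α β) ∈ S.momentSubspace := by
  refine ⟨by rw [Matrix.transpose_add, Matrix.transpose_vecMulVec, Matrix.transpose_vecMulVec,
    add_comm], fun Q R hQR => ?_⟩
  obtain ⟨k, l, k', l', rfl, rfl, h⟩ := exists_of_adjProd_eq_none hQR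
  simp only [map_add, Matrix.add_apply, momentMatrix_vecMulVec, Matrix.vecMulVec_apply,
    prodMixture_vecMul_evalMatrix]
  rcases h with ⟨hne, h_eq⟩ | ⟨hne, h_eq⟩
  · rw [mul_mul_mul_comm, hα k k' hne h_eq, mul_mul_mul_comm (α' ⬝ᵥ _), mul_comm (α' ⬝ᵥ _),
      hα k' k hne.symm h_eq.symm, zero_mul, zero_mul, add_zero]
  · rw [mul_mul_mul_comm, hβ l l' hne h_eq, mul_mul_mul_comm (α' ⬝ᵥ _), mul_comm (β' ⬝ᵥ _),
      hβ l' l hne.symm h_eq.symm, mul_zero, mul_zero, add_zero]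

end ProdMixture

lemma single_self_mem_momentSubspace (s : S.Strategy) :
    Matrix.single s s (1 : ℝ) ∈ S.momentSubspace := by
  have h_mem := vecMulVec_prodMixture_add_mem_momentSubspace (isOrthogonalMixture_single s.1)
    (isOrthogonalMixture_single s.2)
  rw [prodMixture_single_single, ← Matrix.single_eq_single_vecMulVec_single, ← two_smul ℝ] at h_mem
  exact (S.momentSubspace.smul_mem_iff two_ne_zero).1 h_mem

lemma one_mem_momentSubspace : (1 : Matrix S.Strategy S.Strategy ℝ) ∈ S.momentSubspace := by
  rw [← Matrix.sum_single_one]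
  exact sum_mem fun s _ => single_self_mem_momentSubspace s

/-! ### Facets valid on the almost quantum set -/

lemma eq_smul_vecMulVec_of_rows_eq_smul {T : Type*} {β : Matrix T T ℝ} {l : T → ℝ}
    (h_symm : ∀ s s', β s s' = β s' s) (h_diag : ∀ s, β s s = l s)
    (h_rows : ∀ s, ∃ c : ℝ, β s = c • l) {s₀ : T} (hs₀ : l s₀ ≠ 0) :
    β = (l s₀)⁻¹ • Matrix.vecMulVec l l := by
  choose c hc using h_rows
  have h_entry (s s') : β s s' = c s * l s' := by rw [hc, Pi.smul_apply, smul_eq_mul]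
  have h_one : c s₀ = 1 := mul_right_cancel₀ hs₀ (by rw [← h_entry, h_diag, one_mul])
  have h_coeff (s) : c s = (l s₀)⁻¹ * l s := by
    rw [eq_inv_mul_iff_mul_eq₀ hs₀, mul_comm, ← h_entry, h_symm, h_entry, h_one, one_mul]
  ext s s'
  rw [h_entry, h_coeff, Matrix.smul_apply, Matrix.vecMulVec_apply, smul_eq_mul, mul_assoc]

lemma IsFacet.exists_slack_ne_zero [NeZero S.mA] [NeZero S.mB] {B : S.Box} {ω : ℝ}
    (h : IsFacet S.classical B ω) : ∃ s, slack B ω s ≠ 0 := by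
  have ⟨s, hs⟩ := h.exists_dotProduct_detBox_ne ω
  exact ⟨s, sub_ne_zero.2 hs.symm⟩

/-- A row of `β` is an affine function of the deterministic box, which vanishes wherever the slack
does since `β` is positive semidefinite with diagonal the slack; so `IsFacet.exists_eq_mul_sub`
applies. -/
lemma IsFacet.exists_row_eq_smul_slack [NeZero S.mA] [NeZero S.mB] {B : S.Box} {ω : ℝ}
    (h : IsFacet S.classical B ω) {β : Matrix S.Strategy S.Strategy ℝ} (h_psd : β.PosSemidef)
    (h_diag : ∀ s, β s s = slack B ω s) {s : S.Strategy}
    (hs : β s ∈ LinearMap.range S.evalMatrix.mulVecLin) : ∃ c : ℝ, β s = c • slack B ω := by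
  obtain ⟨z, hz⟩ := hs
  have h_affine (r : S.Strategy) : β s r = z none + (fun e => z (some e)) ⬝ᵥ S.detBox r := by
    rw [← hz, Matrix.mulVecLin_apply, Matrix.mulVec, dotProduct, Fintype.sum_option]
    simp [evalMatrix, dotProduct, mul_comm]
  have h_face (r : S.Strategy) (hr : slack B ω r = 0) : β s r = 0 := by
    have h_ker : β *ᵥ Pi.single r 1 = 0 := by
      rw [← h_psd.dotProduct_mulVec_zero_iff]
      simp [h_diag, hr]
    simpa using congrFun h_ker s
  rw [classical_eq_convexHull_range] at h
  obtain ⟨c, hc⟩ := h.exists_eq_mul_sub (Set.forall_mem_range.2 fun r hr =>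
    h_affine r ▸ h_face r (sub_eq_zero.2 hr.symm))
  exact ⟨c, funext fun r => (h_affine r).trans (hc _ (subset_convexHull ℝ _ ⟨r, rfl⟩))⟩

lemma IsFacet.exists_trace_eq_slack [NeZero S.mA] [NeZero S.mB] {B : S.Box} {ω : ℝ}
    (h : IsFacet S.classical B ω) (h_valid : ∀ P ∈ S.almostQuantum, B ⬝ᵥ P ≤ ω) :
    ∃ κ : ℝ, κ ≠ 0 ∧ ∀ c ∈ S.momentSubspace,
      (Matrix.vecMulVec (slack B ω) 1 * c).trace =
        κ * (Matrix.vecMulVec (slack B ω) (slack B ω) * c).trace := by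
  obtain ⟨β, h_psd, h_range, hβ⟩ := exists_posSemidef_trace_extension
    (V := LinearMap.range S.evalMatrix.mulVecLin) (p := S.momentSubspace)
    (φ := Matrix.vecMulVec (slack B ω) 1) (fun c hc => hc.1) one_mem_momentSubspace
    fun c hc h_nonneg => by
      rw [trace_vecMulVec_slack_mul, sub_nonneg]
      exact dotProduct_momentBox_le h_valid hc (posSemidef_momentMatrix hc.1 h_nonneg)
  have h_diag (s) : β s s = slack B ω s := by
    simpa [Matrix.trace_mul_single, Matrix.vecMulVec_apply] using
      hβ _ (single_self_mem_momentSubspace s)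
  obtain ⟨s₀, hs₀⟩ := h.exists_slack_ne_zero
  refine ⟨(slack B ω s₀)⁻¹, inv_ne_zero hs₀, fun c hc => ?_⟩
  rw [← hβ c hc, eq_smul_vecMulVec_of_rows_eq_smul (fun s s' => (h_psd.isHermitian.apply s s').symm)
    h_diag (fun s => h.exists_row_eq_smul_slack h_psd h_diag (h_range s)) hs₀,
    Matrix.smul_mul, Matrix.trace_smul, smul_eq_mul]

theorem IsFacet.slack_mul_slack_eq_zero [NeZero S.mA] [NeZero S.mB] {B : S.Box} {ω : ℝ}
    (h : IsFacet S.classical B ω) (h_valid : ∀ P ∈ S.almostQuantum, B ⬝ᵥ P ≤ ω)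
    {α α' : (∀ x, Fin (S.dA x)) → ℝ} {β β' : (∀ y, Fin (S.dB y)) → ℝ}
    (hα : IsOrthogonalMixture α α') (hβ : IsOrthogonalMixture β β')
    (h_sum : (∑ f, α f) * ∑ h, β h = 0) (h_sum' : (∑ f, α' f) * ∑ h, β' h = 0) :
    (prodMixture α β ⬝ᵥ slack B ω) * (prodMixture α' β' ⬝ᵥ slack B ω) = 0 := by
  obtain ⟨κ, hκ, h_trace⟩ := h.exists_trace_eq_slack h_valid
  have h_eq := h_trace _ (vecMulVec_prodMixture_add_mem_momentSubspace hα hβ)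
  rw [← sum_prodMixture] at h_sum h_sum'
  simp only [Matrix.mul_add, Matrix.trace_add, trace_mul_vecMulVec, Matrix.vecMulVec_mulVec,
    one_dotProduct, h_sum, h_sum', dotProduct_smul, MulOpposite.op_zero, zero_smul,
    op_smul_eq_smul, smul_eq_mul, dotProduct_zero, zero_add, dotProduct_comm (slack B ω)] at h_eq
  linarith [(mul_eq_zero.1 h_eq.symm).resolve_left hκ]

end BellScenario

/-! ### Functionals with orthogonal variations -/

section OrthogonalVariations

variable {X Y : Type*} {α : X → Type*} {β : Y → Type*}

lemma sum_update_sub_sum_update [Fintype X] [DecidableEq X] (g : ∀ x, α x → ℝ) (f : ∀ x, α x)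
    (x₀ : X) (a a' : α x₀) :
    ∑ x, g x (Function.update f x₀ a x) - ∑ x, g x (Function.update f x₀ a' x) =
      g x₀ a - g x₀ a' := by
  rw [← Finset.sum_sub_distrib, Finset.sum_eq_single x₀]
  · rw [Function.update_self, Function.update_self]
  · intro x _ hx
    rw [Function.update_of_ne hx, Function.update_of_ne hx, sub_self]
  · exact fun h => absurd (Finset.mem_univ x₀) h

/-- The second variation of `(f, h) ↦ ∑ x y, L x y (f x) (h y)` in the answers to `x` and `y`. -/
def mixedDiff (L : ∀ x y, α x → β y → ℝ) (x : X) (y : Y) (a₁ a₂ : α x) (b₁ b₂ : β y) : ℝ :=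
  L x y a₁ b₁ - L x y a₂ b₁ - (L x y a₁ b₂ - L x y a₂ b₂)

variable [Fintype X] [Fintype Y]

/-- For the function `(f, h) ↦ ∑ x y, L x y (f x) (h y)` of a pair of strategies, products of
variations in different inputs vanish: of second variations, of variations in Alice's answers, and
of variations in Bob's answers. -/
structure HasOrthogonalVariations (L : ∀ x y, α x → β y → ℝ) : Prop where
  mixed : ∀ {x x' y y'}, x ≠ x' → y ≠ y' → ∀ a₁ a₂ b₁ b₂ a₁' a₂' b₁' b₂',
    mixedDiff L x y a₁ a₂ b₁ b₂ * mixedDiff L x' y' a₁' a₂' b₁' b₂' = 0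
  left : ∀ (h : ∀ y, β y) {x x'}, x ≠ x' → ∀ a₁ a₂ a₁' a₂',
    (∑ y, L x y a₁ (h y) - ∑ y, L x y a₂ (h y)) *
      (∑ y, L x' y a₁' (h y) - ∑ y, L x' y a₂' (h y)) = 0
  right : ∀ (f : ∀ x, α x) {y y'}, y ≠ y' → ∀ b₁ b₂ b₁' b₂',
    (∑ x, L x y (f x) b₁ - ∑ x, L x y (f x) b₂) *
      (∑ x, L x y' (f x) b₁' - ∑ x, L x y' (f x) b₂') = 0

/-- The function `(f, h) ↦ ∑ x y, L x y (f x) (h y)` depends on Alice's strategy `f` only through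
her answer to the input `x₀`. -/
def IsPivot (L : ∀ x y, α x → β y → ℝ) (x₀ : X) : Prop :=
  ∀ x ≠ x₀, ∀ (h : ∀ y, β y) (a₁ a₂ : α x), ∑ y, L x y a₁ (h y) = ∑ y, L x y a₂ (h y)

variable {L : ∀ x y, α x → β y → ℝ}

lemma IsPivot.sum_sum_eq {x₀ : X} (hx₀ : IsPivot L x₀) {f f' : ∀ x, α x} (hf : f x₀ = f' x₀)
    (h : ∀ y, β y) : ∑ x, ∑ y, L x y (f x) (h y) = ∑ x, ∑ y, L x y (f' x) (h y) := by
  refine Finset.sum_congr rfl fun x _ => ?_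
  by_cases hx : x = x₀
  · subst hx
    rw [hf]
  · exact hx₀ x hx h _ _

namespace HasOrthogonalVariations

lemma swap (hL : HasOrthogonalVariations L) :
    HasOrthogonalVariations fun y x b a => L x y a b where
  mixed hy hx b₁ b₂ a₁ a₂ b₁' b₂' a₁' a₂' := by
    rw [← hL.mixed hx hy a₁ a₂ b₁ b₂ a₁' a₂' b₁' b₂', mixedDiff, mixedDiff, mixedDiff, mixedDiff]
    ring
  left := hL.right
  right := hL.left

/-- If changing the answer to `x` matters against `h`, it does not matter against the strategy `h'`
for which changing the answer to `x'` matters; so the effect at `x` depends on Bob's answers. -/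
lemma exists_mixedDiff_ne_zero (hL : HasOrthogonalVariations L) {x x' : X} (hx : x ≠ x')
    {h h' : ∀ y, β y} {a₁ a₂ : α x} {a₁' a₂' : α x'}
    (h_ne : ∑ y, L x y a₁ (h y) ≠ ∑ y, L x y a₂ (h y))
    (h_ne' : ∑ y, L x' y a₁' (h' y) ≠ ∑ y, L x' y a₂' (h' y)) :
    ∃ y b₁ b₂, mixedDiff L x y a₁ a₂ b₁ b₂ ≠ 0 := by
  have h_eq : ∑ y, L x y a₁ (h' y) - ∑ y, L x y a₂ (h' y) = 0 :=
    (mul_eq_zero.1 (hL.left h' hx a₁ a₂ a₁' a₂')).resolve_right (sub_ne_zero.2 h_ne')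
  obtain ⟨y, -, hy⟩ : ∃ y ∈ Finset.univ, mixedDiff L x y a₁ a₂ (h y) (h' y) ≠ 0 := by
    refine Finset.exists_ne_zero_of_sum_ne_zero ?_
    simp only [mixedDiff, Finset.sum_sub_distrib]
    rw [h_eq, sub_zero]
    exact sub_ne_zero.2 h_ne
  exact ⟨y, h y, h' y, hy⟩

lemma mixedDiff_eq_zero (hL : HasOrthogonalVariations L) {x x' : X} (hx : x ≠ x') {y y₀ : Y}
    (hy : y ≠ y₀) {a₁ a₂ : α x} {a₁' a₂' : α x'} {b₁ b₂ b₁' b₂' : β y₀}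
    (h_ne : mixedDiff L x y₀ a₁ a₂ b₁ b₂ ≠ 0) (h_ne' : mixedDiff L x' y₀ a₁' a₂' b₁' b₂' ≠ 0)
    (z : X) (c₁ c₂ : α z) (d₁ d₂ : β y) : mixedDiff L z y c₁ c₂ d₁ d₂ = 0 := by
  by_cases hz : z = x
  · exact (mul_eq_zero.1 (hL.mixed (hz ▸ hx) hy c₁ c₂ d₁ d₂ _ _ _ _)).resolve_right h_ne'
  · exact (mul_eq_zero.1 (hL.mixed hz hy c₁ c₂ d₁ d₂ _ _ _ _)).resolve_right h_ne

/-- The effect of a change at `y ≠ y₀` does not depend on Alice's strategy, and it vanishes for one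
of the two strategies of Alice between which the effect of a change at `y₀` differs. -/
lemma isPivot_swap (hL : HasOrthogonalVariations L) {x x' : X} (hx : x ≠ x')
    {y₀ : Y} {a₁ a₂ : α x} {a₁' a₂' : α x'} {b₁ b₂ b₁' b₂' : β y₀}
    (h_ne : mixedDiff L x y₀ a₁ a₂ b₁ b₂ ≠ 0) (h_ne' : mixedDiff L x' y₀ a₁' a₂' b₁' b₂' ≠ 0) :
    IsPivot (fun y x b a => L x y a b) y₀ := fun y hy f d₁ d₂ => by
  classical
  have h_indep : ∀ f' : ∀ x, α x, ∑ z, L z y (f z) d₁ - ∑ z, L z y (f z) d₂ =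
      ∑ z, L z y (f' z) d₁ - ∑ z, L z y (f' z) d₂ := fun f' => by
    rw [← Finset.sum_sub_distrib, ← Finset.sum_sub_distrib]
    refine Finset.sum_congr rfl fun z _ => ?_
    have := hL.mixedDiff_eq_zero hx hy h_ne h_ne' z (f z) (f' z) d₁ d₂
    rw [mixedDiff] at this
    linear_combination this
  have h_var := sum_update_sub_sum_update (fun z a => L z y₀ a b₁) f x a₁ a₂
  have h_var' := sum_update_sub_sum_update (fun z a => L z y₀ a b₂) f x a₁ a₂
  have h_zero := hL.right (Function.update f x a₁) hy d₁ d₂ b₁ b₂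
  have h_zero' := hL.right (Function.update f x a₂) hy d₁ d₂ b₁ b₂
  rw [← h_indep] at h_zero h_zero'
  have h_mul : (∑ z, L z y (f z) d₁ - ∑ z, L z y (f z) d₂) * mixedDiff L x y₀ a₁ a₂ b₁ b₂ = 0 := by
    rw [mixedDiff, ← h_var, ← h_var']
    linear_combination h_zero - h_zero'
  exact sub_eq_zero.1 ((mul_eq_zero.1 h_mul).resolve_right h_ne)

/-- One of the parties is effectively asked a single question. -/
lemma exists_isPivot_or_exists_isPivot_swap [Nonempty X] (hL : HasOrthogonalVariations L) :
    (∃ x₀, IsPivot L x₀) ∨ ∃ y₀, IsPivot (fun y x b a => L x y a b) y₀ := by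
  by_cases h_two : ∃ (x x' : X) (h h' : ∀ y, β y) (a₁ a₂ : α x) (a₁' a₂' : α x'), x ≠ x' ∧
      ∑ y, L x y a₁ (h y) ≠ ∑ y, L x y a₂ (h y) ∧ ∑ y, L x' y a₁' (h' y) ≠ ∑ y, L x' y a₂' (h' y)
  · obtain ⟨x, x', h, h', a₁, a₂, a₁', a₂', hx, h_ne, h_ne'⟩ := h_two
    obtain ⟨y₀, b₁, b₂, hy₀⟩ := hL.exists_mixedDiff_ne_zero hx h_ne h_ne'
    obtain ⟨y₁, b₁', b₂', hy₁⟩ := hL.exists_mixedDiff_ne_zero hx.symm h_ne' h_ne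
    obtain rfl : y₀ = y₁ := by
      by_contra hy
      exact mul_ne_zero hy₀ hy₁ (hL.mixed hx hy _ _ _ _ _ _ _ _)
    exact Or.inr ⟨y₀, hL.isPivot_swap hx hy₀ hy₁⟩
  · push Not at h_two
    by_cases h_one : ∃ (x : X) (h : ∀ y, β y) (a₁ a₂ : α x),
        ∑ y, L x y a₁ (h y) ≠ ∑ y, L x y a₂ (h y)
    · obtain ⟨x, h, a₁, a₂, h_ne⟩ := h_one
      exact Or.inl ⟨x, fun x' hx' h' a₁' a₂' => h_two x x' h h' a₁ a₂ a₁' a₂' hx'.symm h_ne⟩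
    · push Not at h_one
      exact Or.inl ⟨Classical.arbitrary X, fun x _ => h_one x⟩

lemma exists_forall_ne_sum_eq [Nonempty Y] (hL : HasOrthogonalVariations L) (f : ∀ x, α x) :
    ∃ y₀, ∀ y ≠ y₀, ∀ b₁ b₂, ∑ x, L x y (f x) b₁ = ∑ x, L x y (f x) b₂ := by
  by_cases h_one : ∃ y₀ b₁ b₂, ∑ x, L x y₀ (f x) b₁ ≠ ∑ x, L x y₀ (f x) b₂
  · obtain ⟨y₀, b₁', b₂', h_ne⟩ := h_one
    exact ⟨y₀, fun y hy b₁ b₂ => sub_eq_zero.1 ((mul_eq_zero.1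
      (hL.right f hy b₁ b₂ b₁' b₂')).resolve_right (sub_ne_zero.2 h_ne))⟩
  · push Not at h_one
    exact ⟨Classical.arbitrary Y, fun y _ => h_one y⟩

/-- The value is determined by Alice's answer to `x₀` and by Bob's answer to an input chosen
according to that answer. -/
lemma exists_nonneg_coeff_of_isPivot [Nonempty Y] (hL : HasOrthogonalVariations L)
    (h_nonneg : ∀ (f : ∀ x, α x) (h : ∀ y, β y), 0 ≤ ∑ x, ∑ y, L x y (f x) (h y)) (f₀ : ∀ x, α x)
    (h₀ : ∀ y, β y) {x₀ : X} (hx₀ : IsPivot L x₀) :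
    ∃ M : ∀ x y, α x → β y → ℝ, (∀ x y a b, 0 ≤ M x y a b) ∧
      ∀ (f : ∀ x, α x) (h : ∀ y, β y),
        ∑ x, ∑ y, M x y (f x) (h y) = ∑ x, ∑ y, L x y (f x) (h y) := by
  classical
  choose pivotB h_pivotB using hL.exists_forall_ne_sum_eq
  refine ⟨fun x y a b => if x = x₀ ∧ y = pivotB (Function.update f₀ x a) then
    ∑ x', ∑ y', L x' y' (Function.update f₀ x a x') (Function.update h₀ y b y') else 0,
    fun x y a b => ?_, fun f h => ?_⟩
  · dsimp only
    split_ifs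
    exacts [h_nonneg _ _, le_rfl]
  · set f₁ := Function.update f₀ x₀ (f x₀)
    set y₁ := pivotB f₁
    calc _ = ∑ x, ∑ y, L x y (f₁ x) (Function.update h₀ y₁ (h y₁) y) := by
          rw [Finset.sum_eq_single x₀ (fun x _ hx => by simp [hx]) (by simp),
            Finset.sum_eq_single y₁ (fun y _ hy => if_neg fun h => hy h.2) (by simp),
            if_pos ⟨rfl, rfl⟩]
      _ = ∑ y, ∑ x, L x y (f₁ x) (h y) := by
          rw [Finset.sum_comm]
          refine Finset.sum_congr rfl fun y _ => ?_
          by_cases hy : y = y₁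
          · rw [hy, Function.update_self]
          · exact h_pivotB f₁ y hy _ _
      _ = ∑ x, ∑ y, L x y (f x) (h y) := by
          rw [Finset.sum_comm]
          exact hx₀.sum_sum_eq (Function.update_self ..) h

lemma exists_nonneg_coeff [Nonempty X] [Nonempty Y] (hL : HasOrthogonalVariations L)
    (h_nonneg : ∀ (f : ∀ x, α x) (h : ∀ y, β y), 0 ≤ ∑ x, ∑ y, L x y (f x) (h y)) (f₀ : ∀ x, α x)
    (h₀ : ∀ y, β y) :
    ∃ M : ∀ x y, α x → β y → ℝ, (∀ x y a b, 0 ≤ M x y a b) ∧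
      ∀ (f : ∀ x, α x) (h : ∀ y, β y),
        ∑ x, ∑ y, M x y (f x) (h y) = ∑ x, ∑ y, L x y (f x) (h y) := by
  rcases hL.exists_isPivot_or_exists_isPivot_swap with ⟨x₀, hx₀⟩ | ⟨y₀, hy₀⟩
  · exact hL.exists_nonneg_coeff_of_isPivot h_nonneg f₀ h₀ hx₀
  · obtain ⟨M, hM, hM_sum⟩ := hL.swap.exists_nonneg_coeff_of_isPivot
      (fun h f => Finset.sum_comm.trans_ge (h_nonneg f h)) h₀ f₀ hy₀
    refine ⟨fun x y a b => M y x b a, fun x y a b => hM y x b a, fun f h => ?_⟩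
    rw [Finset.sum_comm, hM_sum, Finset.sum_comm]

end HasOrthogonalVariations

end OrthogonalVariations

namespace BellScenario

variable {S : BellScenario}

/-- The slack of `B · P ≤ ω`, split evenly over the pairs of inputs. -/
def slackCoeff (B : S.Box) (ω : ℝ) (x : Fin S.mA) (y : Fin S.mB) (a : Fin (S.dA x))
    (b : Fin (S.dB y)) : ℝ :=
  ω / (S.mA * S.mB) - B (⟨x, a⟩, ⟨y, b⟩)

section

variable [NeZero S.mA] [NeZero S.mB] {B : S.Box} {ω : ℝ}

lemma sum_slackCoeff (B : S.Box) (ω : ℝ) (f : ∀ x, Fin (S.dA x)) (h : ∀ y, Fin (S.dB y)) :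
    ∑ x, ∑ y, slackCoeff B ω x y (f x) (h y) = slack B ω (f, h) := by
  have hA : (S.mA : ℝ) ≠ 0 := NeZero.ne _
  have hB : (S.mB : ℝ) ≠ 0 := NeZero.ne _
  simp only [slackCoeff, slack, dotProduct_detBox, Finset.sum_sub_distrib, Finset.sum_const,
    Finset.card_univ, Fintype.card_fin, nsmul_eq_mul]
  field_simp

lemma variation_dotProduct_slack_left (B : S.Box) (ω : ℝ) (f : ∀ x, Fin (S.dA x))
    (h : ∀ y, Fin (S.dB y)) (x : Fin S.mA) (a a' : Fin (S.dA x)) :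
    (variation f x a a' ⬝ᵥ fun f => slack B ω (f, h)) =
      ∑ y, slackCoeff B ω x y a (h y) - ∑ y, slackCoeff B ω x y a' (h y) := by
  rw [variation_dotProduct, ← sum_slackCoeff, ← sum_slackCoeff,
    sum_update_sub_sum_update fun x a => ∑ y, slackCoeff B ω x y a (h y)]

lemma variation_dotProduct_slack_right (B : S.Box) (ω : ℝ) (f : ∀ x, Fin (S.dA x))
    (h : ∀ y, Fin (S.dB y)) (y : Fin S.mB) (b b' : Fin (S.dB y)) :
    (variation h y b b' ⬝ᵥ fun h => slack B ω (f, h)) =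
      ∑ x, slackCoeff B ω x y (f x) b - ∑ x, slackCoeff B ω x y (f x) b' := by
  rw [variation_dotProduct, ← sum_slackCoeff, ← sum_slackCoeff, Finset.sum_comm, eq_comm,
    ← sum_update_sub_sum_update (fun y b => ∑ x, slackCoeff B ω x y (f x) b) h, Finset.sum_comm,
    sub_right_inj, Finset.sum_comm]

lemma prodMixture_variation_dotProduct_slack (B : S.Box) (ω : ℝ) (f : ∀ x, Fin (S.dA x))
    (h : ∀ y, Fin (S.dB y)) (x : Fin S.mA) (y : Fin S.mB) (a₁ a₂ : Fin (S.dA x))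
    (b₁ b₂ : Fin (S.dB y)) :
    prodMixture (variation f x a₁ a₂) (variation h y b₁ b₂) ⬝ᵥ slack B ω =
      mixedDiff (slackCoeff B ω) x y a₁ a₂ b₁ b₂ := by
  simp only [prodMixture_dotProduct, variation_dotProduct_slack_right]
  rw [variation_dotProduct, sub_sub_sub_comm,
    sum_update_sub_sum_update fun x a => slackCoeff B ω x y a b₁,
    sum_update_sub_sum_update fun x a => slackCoeff B ω x y a b₂, mixedDiff]

/-- Each of the three conditions is the test of the almost quantum duality on an orthogonal pair of
products of variations and deterministic strategies. -/
lemma IsFacet.hasOrthogonalVariations (h : IsFacet S.classical B ω)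
    (h_valid : ∀ P ∈ S.almostQuantum, B ⬝ᵥ P ≤ ω) (s₀ : S.Strategy) :
    HasOrthogonalVariations (slackCoeff B ω) where
  mixed hx hy a₁ a₂ b₁ b₂ a₁' a₂' b₁' b₂' := by
    have h_zero := h.slack_mul_slack_eq_zero h_valid
      (isOrthogonalMixture_variation s₀.1 s₀.1 hx a₁ a₂ a₁' a₂')
      (isOrthogonalMixture_variation s₀.2 s₀.2 hy b₁ b₂ b₁' b₂')
      (by rw [sum_variation, zero_mul]) (by rw [sum_variation, zero_mul])
    rwa [prodMixture_variation_dotProduct_slack, prodMixture_variation_dotProduct_slack] at h_zero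
  left g x x' hx a₁ a₂ a₁' a₂' := by
    have h_zero := h.slack_mul_slack_eq_zero h_valid
      (isOrthogonalMixture_variation s₀.1 s₀.1 hx a₁ a₂ a₁' a₂') (isOrthogonalMixture_single g)
      (by rw [sum_variation, zero_mul]) (by rw [sum_variation, zero_mul])
    simpa only [prodMixture_dotProduct, single_one_dotProduct, variation_dotProduct_slack_left]
      using h_zero
  right f y y' hy b₁ b₂ b₁' b₂' := by
    have h_zero := h.slack_mul_slack_eq_zero h_valid
      (isOrthogonalMixture_single f) (isOrthogonalMixture_variation s₀.2 s₀.2 hy b₁ b₂ b₁' b₂')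
      (by rw [sum_variation, mul_zero]) (by rw [sum_variation, mul_zero])
    simpa only [prodMixture_dotProduct, single_one_dotProduct, variation_dotProduct_slack_right]
      using h_zero

lemma IsFacet.exists_nonneg_dotProduct_eq_slack (h : IsFacet S.classical B ω)
    (h_valid : ∀ P ∈ S.almostQuantum, B ⬝ᵥ P ≤ ω) (s₀ : S.Strategy) :
    ∃ v : S.Box, 0 ≤ v ∧ ∀ s, v ⬝ᵥ S.detBox s = slack B ω s := by
  obtain ⟨M, hM, hM_sum⟩ := (h.hasOrthogonalVariations h_valid s₀).exists_nonneg_coeff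
    (fun f g => by rw [sum_slackCoeff]; exact h.slack_nonneg (f, g)) s₀.1 s₀.2
  refine ⟨fun e => M e.1.1 e.2.1 e.1.2 e.2.2, fun e => hM .., fun s => ?_⟩
  rw [dotProduct_detBox, hM_sum, sum_slackCoeff]

end

variable {B : S.Box} {ω : ℝ}

theorem IsFacet.isFacet_noSignalling_of_valid_on_almostQuantum (h : IsFacet S.classical B ω)
    (h_valid : ∀ P ∈ S.almostQuantum, B ⬝ᵥ P ≤ ω) : IsFacet S.noSignalling B ω := by
  have := h.neZero_mA
  have := h.neZero_mB
  obtain ⟨s₀, -⟩ := h.exists_slack_ne_zero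
  obtain ⟨v, hv, hv_slack⟩ := h.exists_nonneg_dotProduct_eq_slack h_valid s₀
  refine isFacet_noSignalling h fun P hP => sub_nonneg.1 ?_
  obtain ⟨w, hw, h_eq⟩ := IsNoSignalling.exists_eq_sum_smul_detBox hP
  calc 0 ≤ v ⬝ᵥ P := dotProduct_nonneg_of_nonneg hv hP.nonneg
    _ = ∑ s, w s * slack B ω s := by
      simp only [h_eq, dotProduct_sum, dotProduct_smul, hv_slack, smul_eq_mul]
    _ = ω - B ⬝ᵥ P := by rw [sum_mul_slack, hw, mul_one, ← h_eq]

theorem IsFacetBellInequality.exists_mem_almostQuantum_lt (h : S.IsFacetBellInequality B ω) :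
    ∃ P ∈ S.almostQuantum, ω < B ⬝ᵥ P := by
  by_contra! h_valid
  exact h.2 (h.1.isFacet_noSignalling_of_valid_on_almostQuantum h_valid)

end BellScenario

/-! ### Quantum boxes -/

lemma trace_mul_nonneg_of_posSemidef {𝕜 n : Type*} [RCLike 𝕜] [Fintype n] {A B : Matrix n n 𝕜}
    (hA : A.PosSemidef) (hB : B.PosSemidef) : 0 ≤ (A * B).trace := by
  classical
  obtain ⟨C, rfl⟩ := exists_eq_conjTranspose_mul_self_of_posSemidef hB
  rw [← Matrix.mul_assoc, Matrix.trace_mul_comm, ← Matrix.mul_assoc]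
  exact (hA.mul_mul_conjTranspose_same C).trace_nonneg

namespace BellScenario

lemma IsProjectiveMeasurement.posSemidef {m : ℕ} {d : Fin m → ℕ} {N : ℕ}
    {E : (Σ x : Fin m, Fin (d x)) → Matrix (Fin N) (Fin N) ℂ} (hE : IsProjectiveMeasurement E)
    (k : Σ x : Fin m, Fin (d x)) : (E k).PosSemidef := by
  have h_sq : (E k)ᴴ * E k = E k := by
    rw [(hE.hermitian k).eq, hE.orthogonal k.1 k.2 k.2, if_pos rfl]
  exact h_sq ▸ Matrix.posSemidef_conjTranspose_mul_self (E k)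

variable {S : BellScenario} {NA NB : ℕ}

/-- The box obtained by measuring `E` and `F` on the state `ρ`. -/
def measurementBox (ρ : Matrix (Fin NA × Fin NB) (Fin NA × Fin NB) ℂ)
    (E : S.LetterA → Matrix (Fin NA) (Fin NA) ℂ) (F : S.LetterB → Matrix (Fin NB) (Fin NB) ℂ) :
    S.Box :=
  fun e => (ρ * (E e.1 ⊗ₖ F e.2)).trace.re

section MeasurementBox

variable {ρ : Matrix (Fin NA × Fin NB) (Fin NA × Fin NB) ℂ}
  {E : S.LetterA → Matrix (Fin NA) (Fin NA) ℂ} {F : S.LetterB → Matrix (Fin NB) (Fin NB) ℂ}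

lemma measurementBox_mem_quantum (hρ : ρ.PosSemidef) (h_trace : ρ.trace = 1)
    (hE : IsProjectiveMeasurement E) (hF : IsProjectiveMeasurement F) :
    measurementBox ρ E F ∈ S.quantum :=
  ⟨NA, NB, ρ, E, F, hρ, h_trace, hE, hF, fun k l => by
    have h_nonneg := trace_mul_nonneg_of_posSemidef hρ
      ((hE.posSemidef k).kronecker (hF.posSemidef l))
    exact Complex.ext rfl (Complex.nonneg_iff.1 h_nonneg).2⟩

lemma exists_measurementBox_eq {P : S.Box} (hP : P ∈ S.quantum) :
    ∃ (NA NB : ℕ) (ρ : Matrix (Fin NA × Fin NB) (Fin NA × Fin NB) ℂ)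
      (E : S.LetterA → Matrix (Fin NA) (Fin NA) ℂ) (F : S.LetterB → Matrix (Fin NB) (Fin NB) ℂ),
      ρ.PosSemidef ∧ ρ.trace = 1 ∧ IsProjectiveMeasurement E ∧ IsProjectiveMeasurement F ∧
      measurementBox ρ E F = P := by
  obtain ⟨NA, NB, ρ, E, F, hρ, h_trace, hE, hF, h_box⟩ := hP
  refine ⟨NA, NB, ρ, E, F, hρ, h_trace, hE, hF, funext fun e => ?_⟩
  rw [measurementBox, ← h_box, Complex.ofReal_re]

variable (ρ E F)

lemma sum_sum_mul_measurementBox (x : Fin S.mA) (y : Fin S.mB) (α : Fin (S.dA x) → ℝ)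
    (β : Fin (S.dB y) → ℝ) :
    ∑ a, ∑ b, α a * β b * measurementBox ρ E F (⟨x, a⟩, ⟨y, b⟩) =
      (ρ * ((∑ a, α a • E ⟨x, a⟩) ⊗ₖ ∑ b, β b • F ⟨y, b⟩)).trace.re := by
  have h_sum : (∑ a, α a • E ⟨x, a⟩) ⊗ₖ ∑ b, β b • F ⟨y, b⟩ =
      ∑ a, ∑ b, (α a * β b) • (E ⟨x, a⟩ ⊗ₖ F ⟨y, b⟩) := by
    ext i j
    simp only [Matrix.kroneckerMap_apply, Matrix.sum_apply, Matrix.smul_apply,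
      Finset.sum_mul_sum, smul_mul_smul_comm]
  simp only [h_sum, measurementBox, Matrix.mul_sum, Matrix.trace_sum, Complex.re_sum,
    Matrix.mul_smul, Matrix.trace_smul, Complex.smul_re, smul_eq_mul]

end MeasurementBox

lemma quantum_subset_noSignalling : S.quantum ⊆ S.noSignalling := fun P hP => by
  obtain ⟨NA, NB, ρ, E, F, hρ, h_trace, hE, hF, rfl⟩ := exists_measurementBox_eq hP
  refine ⟨fun e => (Complex.nonneg_iff.1 (trace_mul_nonneg_of_posSemidef hρ
    ((hE.posSemidef e.1).kronecker (hF.posSemidef e.2)))).1, fun x y => ?_,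
    fun x x' y b => ?_, fun y y' x a => ?_⟩
  · simpa [hE.complete, hF.complete, h_trace] using
      sum_sum_mul_measurementBox ρ E F x y (fun _ => 1) (fun _ => 1)
  · have h_marginal (x : Fin S.mA) : ∑ a, measurementBox ρ E F (⟨x, a⟩, ⟨y, b⟩) =
        (ρ * (1 ⊗ₖ F ⟨y, b⟩)).trace.re := by
      simpa [hE.complete, Pi.single_apply, ite_smul] using
        sum_sum_mul_measurementBox ρ E F x y (fun _ => 1) (Pi.single b 1)
    rw [h_marginal, h_marginal]
  · have h_marginal (y : Fin S.mB) : ∑ b, measurementBox ρ E F (⟨x, a⟩, ⟨y, b⟩) =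
        (ρ * (E ⟨x, a⟩ ⊗ₖ 1)).trace.re := by
      simpa [hF.complete, Pi.single_apply, ite_smul] using
        sum_sum_mul_measurementBox ρ E F x y (Pi.single a 1) (fun _ => 1)
    rw [h_marginal, h_marginal]

lemma isProjectiveMeasurement_response {m : ℕ} {d : Fin m → ℕ} (f : ∀ x, Fin (d x)) :
    IsProjectiveMeasurement fun k => response f k • (1 : Matrix (Fin 1) (Fin 1) ℂ) where
  hermitian k := by
    rw [Matrix.IsHermitian, Matrix.conjTranspose_smul, Matrix.conjTranspose_one, star_trivial]
  orthogonal x a a' := by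
    rw [smul_mul_smul_comm, mul_one]
    by_cases h : a = a'
    · by_cases hf : f x = a <;> simp [response, ← h, hf]
    · simp only [response, ite_zero_mul_ite_zero, if_neg h,
        if_neg fun hf : f x = a ∧ f x = a' => h (hf.1.symm.trans hf.2), zero_smul]
  complete x := by rw [← Finset.sum_smul, sum_response, one_smul]

lemma detBox_mem_quantum (s : S.Strategy) : S.detBox s ∈ S.quantum := by
  convert measurementBox_mem_quantum (ρ := 1) Matrix.PosSemidef.one (by simp)
    (isProjectiveMeasurement_response s.1) (isProjectiveMeasurement_response s.2) using 1
  ext e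
  simp [measurementBox, detBox, Matrix.smul_kronecker, Matrix.kronecker_smul, mul_comm]

end BellScenario

/-! ### Tsirelson's construction -/

/-- A linear family of Hermitian matrices, indexed by a Euclidean space, whose squares are given by
the squared norm: a representation of the Clifford relations. -/
structure IsCliffordMap {κ n : Type*} [Fintype κ] [Fintype n] [DecidableEq n]
    (C : (κ → ℝ) →ₗ[ℝ] Matrix n n ℂ) : Prop where
  isHermitian : ∀ u, (C u).IsHermitian
  mul_self : ∀ u, C u * C u = (u ⬝ᵥ u) • 1

namespace IsCliffordMap

variable {κ n : Type*} [Fintype κ] [Fintype n] [DecidableEq n] {C : (κ → ℝ) →ₗ[ℝ] Matrix n n ℂ}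

lemma trace_mul (hC : IsCliffordMap C) (u v : κ → ℝ) :
    (C u * C v).trace = (Fintype.card n * (u ⬝ᵥ v) : ℝ) := by
  have h_self (w : κ → ℝ) : (C w * C w).trace = (Fintype.card n * (w ⬝ᵥ w) : ℝ) := by
    rw [hC.mul_self, Matrix.trace_smul, Matrix.trace_one, Complex.real_smul, mul_comm]
    push_cast
    rfl
  have h_polar := h_self (u + v)
  rw [map_add, add_mul, mul_add, mul_add, Matrix.trace_add, Matrix.trace_add, Matrix.trace_add,
    h_self, h_self, Matrix.trace_mul_comm (C v), add_dotProduct, dotProduct_add, dotProduct_add,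
    dotProduct_comm v u] at h_polar
  push_cast at h_polar ⊢
  linear_combination h_polar / 2

lemma comp_funLeft {κ' : Type*} [Fintype κ'] (hC : IsCliffordMap C) (e : κ ≃ κ') :
    IsCliffordMap (C ∘ₗ LinearMap.funLeft ℝ ℝ e) where
  isHermitian u := hC.isHermitian (u ∘ e)
  mul_self u := by
    rw [LinearMap.comp_apply, hC.mul_self]
    exact congrArg (· • 1) (comp_equiv_dotProduct_comp_equiv u u e)

lemma reindex {m : Type*} [Fintype m] [DecidableEq m] (hC : IsCliffordMap C) (e : n ≃ m) :
    IsCliffordMap ((Matrix.reindexLinearEquiv ℝ ℂ e e).toLinearMap ∘ₗ C) where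
  isHermitian u := (hC.isHermitian u).submatrix e.symm
  mul_self u := by
    simp only [LinearMap.comp_apply, LinearEquiv.coe_coe, Matrix.reindexLinearEquiv_mul,
      hC.mul_self, map_smul, Matrix.reindexLinearEquiv_one]

/-- Adds one generator to a Clifford map, doubling the size of the matrices. -/
def extend (C : (κ → ℝ) →ₗ[ℝ] Matrix n n ℂ) :
    (Option κ → ℝ) →ₗ[ℝ] Matrix (n ⊕ n) (n ⊕ n) ℂ where
  toFun u := Matrix.fromBlocks (C (u ∘ some)) (u none • 1) (u none • 1) (-C (u ∘ some))
  map_add' u v := by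
    rw [show (u + v) ∘ some = u ∘ some + v ∘ some from rfl]
    simp [Matrix.fromBlocks_add, add_smul, add_comm]
  map_smul' r u := by
    rw [show (r • u) ∘ some = r • u ∘ some from rfl]
    simp [Matrix.fromBlocks_smul, mul_smul]

lemma isCliffordMap_extend (hC : IsCliffordMap C) : IsCliffordMap (extend C) where
  isHermitian u := by
    simp [Matrix.IsHermitian, extend, Matrix.fromBlocks_conjTranspose, (hC.isHermitian _).eq]
  mul_self u := by
    have h_dot : u ⬝ᵥ u = u none * u none + u ∘ some ⬝ᵥ u ∘ some := Fintype.sum_option _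
    simp only [extend, LinearMap.coe_mk, AddHom.coe_mk, Matrix.fromBlocks_multiply]
    rw [h_dot, ← Matrix.fromBlocks_one, Matrix.fromBlocks_smul]
    congr 1 <;> simp [hC.mul_self, smul_smul, add_smul, add_comm]

end IsCliffordMap

lemma exists_isCliffordMap (κ : Type*) [Fintype κ] :
    ∃ (N : ℕ) (_ : NeZero N) (C : (κ → ℝ) →ₗ[ℝ] Matrix (Fin N) (Fin N) ℂ), IsCliffordMap C := by
  refine Fintype.induction_empty_option (P := fun κ _ => ∃ (N : ℕ) (_ : NeZero N)
    (C : (κ → ℝ) →ₗ[ℝ] Matrix (Fin N) (Fin N) ℂ), IsCliffordMap C) ?_ ?_ ?_ κ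
  · rintro κ κ' _ e ⟨N, hN, C, hC⟩
    let := Fintype.ofEquiv κ' e.symm
    exact ⟨N, hN, _, hC.comp_funLeft e⟩
  · exact ⟨1, inferInstance, 0, fun _ => Matrix.isHermitian_zero, fun u => by simp⟩
  · rintro κ _ ⟨N, hN, C, hC⟩
    exact ⟨N + N, inferInstance, _, hC.isCliffordMap_extend.reindex finSumFinEquiv⟩

/-- The maximally entangled state. -/
def maxEntangled (N : ℕ) : Matrix (Fin N × Fin N) (Fin N × Fin N) ℂ :=
  (N : ℂ)⁻¹ • Matrix.vecMulVec (fun p => if p.1 = p.2 then 1 else 0)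
    (star fun p => if p.1 = p.2 then 1 else 0)

lemma posSemidef_maxEntangled (N : ℕ) : (maxEntangled N).PosSemidef :=
  (Matrix.posSemidef_vecMulVec_self_star _).smul (by positivity)

lemma trace_maxEntangled_mul_kronecker {N : ℕ} (X Y : Matrix (Fin N) (Fin N) ℂ) :
    (maxEntangled N * (X ⊗ₖ Y)).trace = (N : ℂ)⁻¹ * (X * Yᵀ).trace := by
  rw [maxEntangled, Matrix.smul_mul, Matrix.trace_smul, smul_eq_mul]
  congr 1
  simp only [Matrix.vecMulVec_mul, Matrix.trace_vecMulVec, dotProduct, Fintype.sum_prod_type,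
    Matrix.vecMul, Pi.star_apply, Matrix.kroneckerMap_apply, apply_ite star, star_one, star_zero,
    ite_mul, one_mul, zero_mul, Finset.sum_ite_eq, Finset.mem_univ, if_true]
  simp only [Matrix.trace, Matrix.diag_apply, Matrix.mul_apply, Matrix.transpose_apply]
  exact Finset.sum_comm

lemma trace_maxEntangled (N : ℕ) [NeZero N] : (maxEntangled N).trace = 1 := by
  simpa using trace_maxEntangled_mul_kronecker (1 : Matrix (Fin N) (Fin N) ℂ) 1

/-- The sign `(-1) ^ a` of a bit `a`. -/
def bitSign (a : Fin 2) : ℝ := (-1) ^ (a : ℕ)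

lemma bitSign_mul_self (a : Fin 2) : bitSign a * bitSign a = 1 := by
  fin_cases a <;> simp [bitSign]

lemma bitSign_rev (a : Fin 2) : bitSign a.rev = -bitSign a := by
  fin_cases a <;> simp [bitSign]

/-- The spectral projection of an involution `A` for the eigenvalue `(-1) ^ a`. -/
def bitProjection {N : ℕ} (A : Matrix (Fin N) (Fin N) ℂ) (a : Fin 2) : Matrix (Fin N) (Fin N) ℂ :=
  (2⁻¹ : ℝ) • (1 + bitSign a • A)

lemma sum_bitProjection {N : ℕ} (A : Matrix (Fin N) (Fin N) ℂ) : ∑ a, bitProjection A a = 1 := by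
  simp only [bitProjection, bitSign, Fin.sum_univ_two, Fin.val_zero, Fin.val_one]
  module

lemma sum_bitSign_smul_bitProjection {N : ℕ} (A : Matrix (Fin N) (Fin N) ℂ) :
    ∑ a, bitSign a • bitProjection A a = A := by
  simp only [bitProjection, bitSign, Fin.sum_univ_two, Fin.val_zero, Fin.val_one]
  module

lemma isHermitian_bitProjection {N : ℕ} {A : Matrix (Fin N) (Fin N) ℂ} (hA : A.IsHermitian)
    (a : Fin 2) : (bitProjection A a).IsHermitian :=
  (Matrix.isHermitian_one.add (hA.smul (IsSelfAdjoint.all _))).smul (IsSelfAdjoint.all _)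

lemma bitProjection_mul {N : ℕ} {A : Matrix (Fin N) (Fin N) ℂ} (h_sq : A * A = 1) (a a' : Fin 2) :
    bitProjection A a * bitProjection A a' = if a = a' then bitProjection A a else 0 := by
  have h_mul : bitProjection A a * bitProjection A a' =
      (4⁻¹ : ℝ) • ((1 + bitSign a * bitSign a') • 1 + (bitSign a + bitSign a') • A) := by
    simp only [bitProjection, smul_mul_smul_comm, add_mul, mul_add, one_mul, mul_one, h_sq]
    module
  rw [h_mul]
  split_ifs with h
  · rw [← h, bitSign_mul_self, bitProjection]
    module
  · have h_opposite : bitSign a + bitSign a' = 0 ∧ bitSign a * bitSign a' = -1 := by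
      fin_cases a <;> fin_cases a' <;> simp_all [bitSign]
    rw [h_opposite.1, h_opposite.2, add_neg_cancel, zero_smul, zero_smul, add_zero, smul_zero]

namespace BellScenario

variable {mA mB : ℕ}

lemma isProjectiveMeasurement_bitProjection {m N : ℕ} {A : Fin m → Matrix (Fin N) (Fin N) ℂ}
    (hA : ∀ x, (A x).IsHermitian) (h_sq : ∀ x, A x * A x = 1) :
    IsProjectiveMeasurement (d := fun _ => 2) fun k => bitProjection (A k.1) k.2 where
  hermitian k := isHermitian_bitProjection (hA k.1) k.2
  orthogonal x a a' := bitProjection_mul (h_sq x) a a'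
  complete x := sum_bitProjection (A x)

/-- The expectation of `(-1) ^ (a + b)` under `P(a, b | x, y)`. -/
def correlator (P : (binary mA mB).Box) (x : Fin mA) (y : Fin mB) : ℝ :=
  ∑ a : Fin 2, ∑ b : Fin 2, bitSign a * bitSign b * P (⟨x, a⟩, ⟨y, b⟩)

lemma correlator_detBox (f : Fin mA → Fin 2) (h : Fin mB → Fin 2) (x : Fin mA) (y : Fin mB) :
    correlator ((binary mA mB).detBox (f, h)) x y = bitSign (f x) * bitSign (h y) := by
  have h_mul (a b : Fin 2) : bitSign a * bitSign b *
      ((binary mA mB).detBox (f, h)) (⟨x, a⟩, ⟨y, b⟩) =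
      response (d := fun _ => 2) f ⟨x, a⟩ * bitSign a *
        (response (d := fun _ => 2) h ⟨y, b⟩ * bitSign b) := by
    change _ * (response (d := fun _ => 2) f ⟨x, a⟩ * response (d := fun _ => 2) h ⟨y, b⟩) = _
    ring
  simp only [correlator, h_mul, ← Finset.sum_mul_sum]
  rw [sum_response_mul (d := fun _ => 2), sum_response_mul (d := fun _ => 2)]

theorem exists_mem_quantum_correlator_eq {C : Matrix (Fin mA ⊕ Fin mB) (Fin mA ⊕ Fin mB) ℝ}
    (hC : C.PosSemidef) (h_diag : ∀ i, C i i = 1) :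
    ∃ P ∈ (binary mA mB).quantum, ∀ x y, correlator P x y = C (Sum.inl x) (Sum.inr y) := by
  obtain ⟨U, rfl⟩ := exists_eq_conjTranspose_mul_self_of_posSemidef hC
  obtain ⟨N, _, Φ, hΦ⟩ := exists_isCliffordMap (Fin mA ⊕ Fin mB)
  have h_sq (i) : Φ (U.col i) * Φ (U.col i) = 1 := by
    rw [hΦ.mul_self, show U.col i ⬝ᵥ U.col i = 1 from h_diag i, one_smul]
  refine ⟨_, measurementBox_mem_quantum (posSemidef_maxEntangled N) (trace_maxEntangled N)
    (isProjectiveMeasurement_bitProjection (A := fun x => Φ (U.col (Sum.inl x)))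
      (fun x => hΦ.isHermitian _) fun x => h_sq _)
    (isProjectiveMeasurement_bitProjection (A := fun y => (Φ (U.col (Sum.inr y)))ᵀ)
      (fun y => (hΦ.isHermitian _).transpose) fun y => by
        rw [← Matrix.transpose_mul, h_sq, Matrix.transpose_one]), fun x y => ?_⟩
  have h_expectation := sum_sum_mul_measurementBox (S := binary mA mB) (maxEntangled N)
    (fun k => bitProjection (Φ (U.col (Sum.inl k.1))) k.2)
    (fun k => bitProjection (Φ (U.col (Sum.inr k.1)))ᵀ k.2) x y bitSign bitSign
  refine h_expectation.trans ?_
  change (maxEntangled N * ((∑ a : Fin 2, bitSign a • bitProjection (Φ (U.col (Sum.inl x))) a) ⊗ₖ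
    ∑ b : Fin 2, bitSign b • bitProjection (Φ (U.col (Sum.inr y)))ᵀ b)).trace.re = _
  rw [sum_bitSign_smul_bitProjection, sum_bitSign_smul_bitProjection,
    trace_maxEntangled_mul_kronecker, Matrix.transpose_transpose, hΦ.trace_mul, Fintype.card_fin]
  have hN : (N : ℝ) ≠ 0 := NeZero.ne _
  rw [← Complex.ofReal_natCast, ← Complex.ofReal_inv, ← Complex.ofReal_mul, Complex.ofReal_re,
    inv_mul_cancel_left₀ hN]
  rfl

end BellScenario

/-! ### Duality for correlation matrices -/

section ConstDiag

variable {I : Type*}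

/-- The symmetric matrices with constant diagonal. -/
def constDiag (I : Type*) : Submodule ℝ (Matrix I I ℝ) where
  carrier := {c | cᵀ = c ∧ ∀ i j, c i i = c j j}
  add_mem' hc hd :=
    ⟨by rw [Matrix.transpose_add, hc.1, hd.1], fun i j => congrArg₂ (· + ·) (hc.2 i j) (hd.2 i j)⟩
  zero_mem' := ⟨Matrix.transpose_zero, fun _ _ => rfl⟩
  smul_mem' r c hc :=
    ⟨by rw [Matrix.transpose_smul, hc.1], fun i j => congrArg (r * ·) (hc.2 i j)⟩

variable [Fintype I]

lemma apply_eq_apply_of_trace_mul_eq {β φ : Matrix I I ℝ} (hβ : βᵀ = β) (hφ : φᵀ = φ)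
    (h : ∀ c ∈ constDiag I, (β * c).trace = (φ * c).trace) {i j : I} (hij : i ≠ j) :
    β i j = φ i j := by
  classical
  have h_mem : Matrix.single i j (1 : ℝ) + Matrix.single j i 1 ∈ constDiag I := by
    refine ⟨by simp [add_comm], fun k l => ?_⟩
    have h_zero (k : I) :
        (Matrix.single i j 1 + Matrix.single j i 1 : Matrix I I ℝ) k k = 0 := by
      rw [Matrix.add_apply, Matrix.single_apply_of_ne, Matrix.single_apply_of_ne, add_zero] <;>
        rintro ⟨rfl, rfl⟩ <;> exact hij rfl
    rw [h_zero, h_zero]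
  have h_trace (M : Matrix I I ℝ) (hM : Mᵀ = M) :
      (M * (Matrix.single i j 1 + Matrix.single j i 1)).trace = 2 * M i j := by
    have h_symm : M j i = M i j := congrFun₂ hM i j
    rw [mul_add, Matrix.trace_add, Matrix.trace_mul_single, Matrix.trace_mul_single, h_symm,
      MulOpposite.op_one, one_smul, two_mul]
  have h_two := h _ h_mem
  rw [h_trace β hβ, h_trace φ hφ] at h_two
  exact mul_left_cancel₀ two_ne_zero h_two

variable {W : Matrix I I ℝ} {t : ℝ}

lemma trace_mul_le_mul_of_diag_eq (h : ∀ C : Matrix I I ℝ, C.PosSemidef → (∀ i, C i i = 1) →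
    (W * C).trace ≤ t) {C : Matrix I I ℝ} (hC : C.PosSemidef) {r : ℝ} (h_diag : ∀ i, C i i = r)
    (hr : 0 ≤ r) : (W * C).trace ≤ r * t := by
  rcases hr.eq_or_lt with rfl | hr
  · have h_zero : C = 0 := hC.trace_eq_zero_iff.1 (Finset.sum_eq_zero fun i _ => h_diag i)
    simp [h_zero]
  · have h_le := h (r⁻¹ • C) (hC.smul (inv_nonneg.2 hr.le)) fun i => by
      rw [Matrix.smul_apply, h_diag, smul_eq_mul, inv_mul_cancel₀ hr.ne']
    rwa [Matrix.mul_smul, Matrix.trace_smul, smul_eq_mul, inv_mul_le_iff₀ hr] at h_le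

theorem exists_posSemidef_diagonal_sub [DecidableEq I] [Nonempty I] (hW : Wᵀ = W)
    (h : ∀ C : Matrix I I ℝ, C.PosSemidef → (∀ i, C i i = 1) → (W * C).trace ≤ t) :
    ∃ l : I → ℝ, (Matrix.diagonal l - W).PosSemidef ∧ ∑ i, l i = t := by
  have h_one : (1 : Matrix I I ℝ) ∈ constDiag I := ⟨Matrix.transpose_one, by simp⟩
  have h_card : (Fintype.card I : ℝ) ≠ 0 := by simp
  obtain ⟨β, hβ, -, hβ_trace⟩ := exists_posSemidef_trace_extension (V := ⊤) (p := constDiag I)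
    (φ := (t / Fintype.card I) • 1 - W) (fun c hc => hc.1) h_one fun c hc hc_nonneg => by
      obtain ⟨i₀⟩ := ‹Nonempty I›
      have hc_psd : c.PosSemidef := .of_dotProduct_mulVec_nonneg
        (by simpa [Matrix.IsHermitian] using hc.1) fun u => hc_nonneg u trivial
      have h_le := trace_mul_le_mul_of_diag_eq h hc_psd (fun i => hc.2 i i₀) hc_psd.diag_nonneg
      have h_trace : c.trace = Fintype.card I * c i₀ i₀ := by
        simp [Matrix.trace, fun i => hc.2 i i₀]
      rw [sub_mul, Matrix.smul_mul, one_mul, Matrix.trace_sub, Matrix.trace_smul, h_trace,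
        smul_eq_mul, ← mul_assoc, div_mul_cancel₀ t h_card]
      linarith
  refine ⟨fun i => β i i + W i i, ?_, ?_⟩
  · convert hβ using 1
    ext i j
    rcases eq_or_ne i j with rfl | hij
    · simp
    · have h_off := apply_eq_apply_of_trace_mul_eq (by simpa [Matrix.IsHermitian] using hβ.1)
        (by simp [Matrix.transpose_sub, hW]) hβ_trace hij
      simp [hij, h_off]
  · have h_trace := hβ_trace 1 h_one
    simp only [mul_one, Matrix.trace_sub, Matrix.trace_smul, Matrix.trace_one, smul_eq_mul,
      div_mul_cancel₀ t h_card] at h_trace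
    rw [Finset.sum_add_distrib]
    exact eq_sub_iff_add_eq.1 h_trace

lemma mul_eq_mulVec_of_posSemidef_diagonal_sub [DecidableEq I] {l s : I → ℝ}
    (h_psd : (Matrix.diagonal l - W).PosSemidef) (hs : ∀ i, s i * s i = 1)
    (h_eq : s ⬝ᵥ W *ᵥ s = ∑ i, l i) (i : I) : l i * s i = (W *ᵥ s) i := by
  have h_form : s ⬝ᵥ (Matrix.diagonal l - W) *ᵥ s = 0 := by
    have h_diag : s ⬝ᵥ Matrix.diagonal l *ᵥ s = ∑ i, l i :=
      Finset.sum_congr rfl fun i _ => by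
        rw [Matrix.mulVec_diagonal, mul_left_comm, hs, mul_one]
    rw [Matrix.sub_mulVec, dotProduct_sub, h_diag, h_eq, sub_self]
  have h_ker := congrFun ((h_psd.dotProduct_mulVec_zero_iff s).1 (by simpa using h_form)) i
  rw [Matrix.sub_mulVec, Pi.sub_apply, Matrix.mulVec_diagonal] at h_ker
  exact sub_eq_zero.1 h_ker

end ConstDiag

namespace BellScenario

/-! ### Facets in terms of correlators -/

variable {mA mB : ℕ} {B : (binary mA mB).Box} {W : Matrix (Fin mA) (Fin mB) ℝ} {k ω : ℝ}

lemma exists_dotProduct_detBox_eq_sub [NeZero mB] (x : Fin mA) (l : ℝ) (w : Fin mB → ℝ) :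
    ∃ v : (binary mA mB).Box, ∀ (f : Fin mA → Fin 2) (h : Fin mB → Fin 2),
      v ⬝ᵥ (binary mA mB).detBox (f, h) = l * bitSign (f x) - ∑ y, w y * bitSign (h y) := by
  let v (x' : Fin mA) (y : Fin mB) (a b : Fin 2) : ℝ :=
    if x' = x then l / mB * bitSign a - w y * bitSign b else 0
  refine ⟨fun e => v e.1.1 e.2.1 e.1.2 e.2.2, fun f h => ?_⟩
  have h_mB : (mB : ℝ) ≠ 0 := NeZero.ne _
  calc _ = ∑ x', ∑ y, v x' y (f x') (h y) := dotProduct_detBox _ _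
    _ = ∑ y, (l / mB * bitSign (f x) - w y * bitSign (h y)) := by
      rw [Fintype.sum_eq_single x fun x' hx' => Finset.sum_eq_zero fun y _ => if_neg hx']
      exact Finset.sum_congr rfl fun y _ => if_pos rfl
    _ = l * bitSign (f x) - ∑ y, w y * bitSign (h y) := by
      rw [Finset.sum_sub_distrib, Finset.sum_const, Finset.card_univ, Fintype.card_fin,
        nsmul_eq_mul, ← mul_assoc, mul_div_cancel₀ l h_mB]

/-- The Bell functional `B` depends only on the correlators of a no-signalling box: it is the
affine function of them with constant term `k` and weights `W`. -/
def IsCorrelatorForm (B : (binary mA mB).Box) (W : Matrix (Fin mA) (Fin mB) ℝ) (k : ℝ) : Prop :=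
  ∀ P ∈ (binary mA mB).noSignalling, B ⬝ᵥ P = k + ∑ x, ∑ y, W x y * correlator P x y

/-- The symmetric matrix on the inputs of both parties with off-diagonal blocks `W` and `Wᵀ`. -/
def biadjacency (W : Matrix (Fin mA) (Fin mB) ℝ) : Matrix (Fin mA ⊕ Fin mB) (Fin mA ⊕ Fin mB) ℝ :=
  Matrix.fromBlocks 0 W Wᵀ 0

lemma trace_biadjacency_mul {C : Matrix (Fin mA ⊕ Fin mB) (Fin mA ⊕ Fin mB) ℝ} (hC : Cᵀ = C) :
    (biadjacency W * C).trace = 2 * ∑ x, ∑ y, W x y * C (Sum.inl x) (Sum.inr y) := by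
  have h_symm (x y) : C (Sum.inr y) (Sum.inl x) = C (Sum.inl x) (Sum.inr y) :=
    congrFun₂ hC (Sum.inl x) (Sum.inr y)
  simp only [biadjacency, Matrix.trace, Matrix.diag_apply, Matrix.mul_apply, Fintype.sum_sum_type,
    Matrix.fromBlocks_apply₁₁, Matrix.fromBlocks_apply₁₂, Matrix.fromBlocks_apply₂₁,
    Matrix.fromBlocks_apply₂₂, Matrix.zero_apply, Matrix.transpose_apply, zero_mul,
    Finset.sum_const_zero, zero_add, add_zero, h_symm]
  rw [Finset.sum_comm (f := fun y x => W x y * C (Sum.inl x) (Sum.inr y)), two_mul]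

namespace IsCorrelatorForm

lemma dotProduct_detBox (hB : IsCorrelatorForm B W k) (f : Fin mA → Fin 2) (h : Fin mB → Fin 2) :
    B ⬝ᵥ (binary mA mB).detBox (f, h) =
      k + ∑ x, ∑ y, W x y * (bitSign (f x) * bitSign (h y)) := by
  rw [hB _ (detBox_mem_localDeterministic _).1]
  simp only [correlator_detBox]

lemma trace_biadjacency_mul_le (hB : IsCorrelatorForm B W k)
    (h_valid : ∀ P ∈ (binary mA mB).quantum, B ⬝ᵥ P ≤ ω)
    {C : Matrix (Fin mA ⊕ Fin mB) (Fin mA ⊕ Fin mB) ℝ} (hC : C.PosSemidef)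
    (h_diag : ∀ i, C i i = 1) : (biadjacency W * C).trace ≤ 2 * (ω - k) := by
  obtain ⟨P, hP, h_corr⟩ := exists_mem_quantum_correlator_eq hC h_diag
  have h_le := h_valid P hP
  rw [hB P (quantum_subset_noSignalling hP)] at h_le
  simp only [h_corr] at h_le
  rw [trace_biadjacency_mul (by simpa [Matrix.IsHermitian] using hC.1)]
  linarith

/-- Complementary slackness, with dual solution `l`. -/
lemma exists_mul_bitSign_eq [NeZero mA] (hB : IsCorrelatorForm B W k)
    (h_valid : ∀ P ∈ (binary mA mB).quantum, B ⬝ᵥ P ≤ ω) :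
    ∃ l : Fin mA → ℝ, ∀ (f : Fin mA → Fin 2) (h : Fin mB → Fin 2),
      B ⬝ᵥ (binary mA mB).detBox (f, h) = ω →
        ∀ x, l x * bitSign (f x) = ∑ y, W x y * bitSign (h y) := by
  have h_symm : (biadjacency W)ᵀ = biadjacency W := by
    simp [biadjacency, Matrix.fromBlocks_transpose]
  obtain ⟨l, h_psd, h_sum⟩ := exists_posSemidef_diagonal_sub h_symm
    fun C => hB.trace_biadjacency_mul_le h_valid
  refine ⟨fun x => l (Sum.inl x), fun f h h_eq x => ?_⟩
  let s : Fin mA ⊕ Fin mB → ℝ := Sum.elim (bitSign ∘ f) (bitSign ∘ h)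
  have h_form : s ⬝ᵥ biadjacency W *ᵥ s = ∑ i, l i := by
    rw [← trace_mul_vecMulVec, trace_biadjacency_mul (Matrix.transpose_vecMulVec s s), h_sum]
    rw [hB.dotProduct_detBox] at h_eq
    simp only [Matrix.vecMulVec_apply, s, Sum.elim_inl, Sum.elim_inr, Function.comp_apply]
    linarith
  have h_row := mul_eq_mulVec_of_posSemidef_diagonal_sub h_psd
    (by rintro (x | y) <;> exact bitSign_mul_self _) h_form (Sum.inl x)
  simpa [s, biadjacency, Matrix.mulVec, dotProduct] using h_row

/-- The difference of both sides of `exists_mul_bitSign_eq` is an affine function of the box which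
vanishes on the facet, hence a multiple of the slack. It is odd under flipping all outputs of both
parties, whereas the slack is even. -/
lemma sum_mul_bitSign_eq_zero [NeZero mA] [NeZero mB] (hB : IsCorrelatorForm B W k)
    (h_facet : IsFacet (binary mA mB).classical B ω)
    (h_valid : ∀ P ∈ (binary mA mB).quantum, B ⬝ᵥ P ≤ ω) (x : Fin mA) (h : Fin mB → Fin 2) :
    ∑ y, W x y * bitSign (h y) = 0 := by
  have : NeZero (binary mA mB).mA := ‹NeZero mA›
  have : NeZero (binary mA mB).mB := ‹NeZero mB›
  obtain ⟨l, hl⟩ := hB.exists_mul_bitSign_eq h_valid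
  obtain ⟨v, hv⟩ := exists_dotProduct_detBox_eq_sub x (l x) (W x)
  obtain ⟨c, hc⟩ := IsFacet.exists_eq_mul_sub (v := v) (k := 0) h_facet fun P hP hPω => by
    obtain ⟨⟨f, h⟩, rfl⟩ := exists_detBox_eq hP
    exact (zero_add _).trans ((hv f h).trans (sub_eq_zero.2 (hl f h hPω x)))
  have h_slack (f : Fin mA → Fin 2) (h : Fin mB → Fin 2) :
      l x * bitSign (f x) - ∑ y, W x y * bitSign (h y) =
        c * (ω - (k + ∑ x, ∑ y, W x y * (bitSign (f x) * bitSign (h y)))) := by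
    rw [← hv, ← hB.dotProduct_detBox, ← hc _ (detBox_mem_classical _), zero_add]
  have h_eq (f : Fin mA → Fin 2) (h : Fin mB → Fin 2) :
      l x * bitSign (f x) = ∑ y, W x y * bitSign (h y) := by
    have h_flip := h_slack (Fin.rev ∘ f) (Fin.rev ∘ h)
    simp only [Function.comp_apply, bitSign_rev, mul_neg, neg_mul, neg_neg,
      Finset.sum_neg_distrib] at h_flip
    linarith [h_slack f h]
  have h_flip := h_eq 0 (Fin.rev ∘ h)
  simp only [Function.comp_apply, bitSign_rev, mul_neg, Finset.sum_neg_distrib] at h_flip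
  linarith [h_eq 0 h]

end IsCorrelatorForm

theorem IsFacet.exists_mem_quantum_lt (hB : IsCorrelatorForm B W k)
    (h : IsFacet (binary mA mB).classical B ω) : ∃ P ∈ (binary mA mB).quantum, ω < B ⬝ᵥ P := by
  have : NeZero (binary mA mB).mA := h.neZero_mA
  have : NeZero (binary mA mB).mB := h.neZero_mB
  have : NeZero mA := ‹NeZero (binary mA mB).mA›
  have : NeZero mB := ‹NeZero (binary mA mB).mB›
  by_contra! h_valid
  obtain ⟨⟨f, g⟩, h_ne⟩ := h.exists_dotProduct_detBox_ne k
  refine h_ne ((hB.dotProduct_detBox f g).trans (add_eq_left.2 (Finset.sum_eq_zero fun x _ => ?_)))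
  simp only [mul_left_comm (W x _), ← Finset.mul_sum]
  exact mul_eq_zero_of_right _ (hB.sum_mul_bitSign_eq_zero h h_valid x g)

/-! ### Values and XOR games -/

lemma IsFacet.quantum_nonempty {S : BellScenario} {B : S.Box} {ω : ℝ}
    (h : IsFacet S.classical B ω) : S.quantum.Nonempty := by
  have := h.neZero_mA
  have := h.neZero_mB
  obtain ⟨s, -⟩ := h.exists_dotProduct_detBox_ne 0
  exact ⟨_, detBox_mem_quantum s⟩

lemma exists_mem_quantum_lt_of_value_eq {S : BellScenario} {B : S.Box} {ω : ℝ}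
    (h_ne : S.quantum.Nonempty) (h_value : value S.quantum B = value S.almostQuantum B)
    (h : ∃ P ∈ S.almostQuantum, ω < B ⬝ᵥ P) : ∃ P ∈ S.quantum, ω < B ⬝ᵥ P := by
  obtain ⟨P, hP, hlt⟩ := h
  have h_lt : ω < value S.quantum B := h_value ▸ hlt.trans_le (le_value (fun _ => And.left) B hP)
  obtain ⟨_, ⟨Q, hQ, rfl⟩, hQ_lt⟩ := exists_lt_of_lt_csSup (h_ne.image _) h_lt
  exact ⟨Q, hQ, hQ_lt⟩

theorem IsFacet.value_lt_value_quantum (hB : IsCorrelatorForm B W k)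
    (h : IsFacet (binary mA mB).classical B ω) :
    value (binary mA mB).classical B < value (binary mA mB).quantum B := by
  obtain ⟨P, hP, hlt⟩ := h.exists_mem_quantum_lt hB
  exact h.value_eq.trans_lt (hlt.trans_le (le_value quantum_subset_noSignalling B hP))

end BellScenario

open BellScenario

lemma ite_add_eq_eq_bitSign (a b c : Fin 2) (q : ℝ) :
    (if a + b = c then q else 0) = q / 2 + q * bitSign c / 2 * (bitSign a * bitSign b) := by
  fin_cases a <;> fin_cases b <;> fin_cases c <;> simp [bitSign] <;> ring

lemma XORGame.isCorrelatorForm_bell {mA mB : ℕ} (G : XORGame mA mB) :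
    IsCorrelatorForm G.bell (fun x y => G.q x y * bitSign (G.f x y) / 2) (1 / 2) := fun P hP => by
  have h_pair (x : Fin mA) (y : Fin mB) :
      ∑ a : Fin 2, ∑ b : Fin 2, G.bell (⟨x, a⟩, ⟨y, b⟩) * P (⟨x, a⟩, ⟨y, b⟩) =
        G.q x y / 2 + G.q x y * bitSign (G.f x y) / 2 * correlator P x y := by
    have h_one : ∑ a : Fin 2, ∑ b : Fin 2, P (⟨x, a⟩, ⟨y, b⟩) = 1 := hP.normalized x y
    simp only [XORGame.bell, ite_add_eq_eq_bitSign, add_mul, mul_assoc, Finset.sum_add_distrib,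
      ← Finset.mul_sum, h_one, mul_one, correlator]
  have h_sum : G.bell ⬝ᵥ P = ∑ x : Fin mA, ∑ y : Fin mB, ∑ a : Fin 2, ∑ b : Fin 2,
      G.bell (⟨x, a⟩, ⟨y, b⟩) * P (⟨x, a⟩, ⟨y, b⟩) := by
    simp only [dotProduct, Fintype.sum_prod_type, Fintype.sum_sigma]
    exact Finset.sum_congr rfl fun x _ => Finset.sum_comm
  simp only [h_sum, h_pair, Finset.sum_add_distrib, ← Finset.sum_div, G.q_sum]

theorem mainTheorem2_general :
    (∀ (S : BellScenario) (B : S.Box) (ω : ℝ),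
      S.IsFacetBellInequality B ω → ∃ P ∈ S.almostQuantum, ω < B ⬝ᵥ P) ∧
    (∀ (mA mB : ℕ) (B : (binary mA mB).Box) (W : Matrix (Fin mA) (Fin mB) ℝ) (k ω : ℝ),
      IsCorrelatorForm B W k → IsFacet (binary mA mB).classical B ω →
      value (binary mA mB).classical B < value (binary mA mB).quantum B) :=
  ⟨fun _ _ _ h => h.exists_mem_almostQuantum_lt,
    fun _ _ _ _ _ _ hB h => h.value_lt_value_quantum hB⟩

end

theorem mainTheorem2 :
    (∀ (S : BellScenario) (B : S.Box) (ω : ℝ),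
      S.IsFacetBellInequality B ω →
      BellScenario.value S.quantum B = BellScenario.value S.almostQuantum B →
      ∃ P ∈ S.quantum, ω < B ⬝ᵥ P) ∧
    (∀ (mA mB : ℕ) (G : XORGame mA mB) (ω : ℝ),
      BellScenario.IsFacet (BellScenario.binary mA mB).classical G.bell ω →
      BellScenario.value (BellScenario.binary mA mB).classical G.bell <
        BellScenario.value (BellScenario.binary mA mB).quantum G.bell) :=
  ⟨fun S B ω h h_value => BellScenario.exists_mem_quantum_lt_of_value_eq
      h.1.quantum_nonempty h_value (mainTheorem2_general.1 S B ω h),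
    fun mA mB G ω => mainTheorem2_general.2 mA mB _ _ _ ω G.isCorrelatorForm_bell⟩
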